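/- Let $\mathcal H=\ell^2(\mathbb N,\mathbb C)$ be the single-mode Hilbert space with Fock basis $(|n\rangle)_{n\in\mathbb N}$ and number operator $\hat n=\sum_n n|n\rangle\langle n|$, let $\mathcal H_N=\mathrm{span}\{|0\rangle,\dots,|N\rangle\}$ with orthogonal projector $\Pi_N$, and let $\mathcal S\subset\mathcal H$ be the Schwartz space of all $\sum_n c_n|n\rangle$ with $\lim_{n\to\infty}c_nn^k=0$ for every $k\in\mathbb N$. For a unitary $U$ on $\mathcal H$ and real $x\ge 0$ put $E_U(x)=\sup\{\langle\psi|U^\dagger\hat nU|\psi\rangle:\psi\in\mathcal H_{\lfloor x\rfloor},\ \|\psi\|=1\}$. For a difference $\mathcal E$ of two unitary channels put $\|\mathcal E\|_\diamond^E=\sup\|(\mathcal E\otimes\mathrm{id})\rho\|_1$, the supremum over all density operators $\rho$ on $\mathcal H\otimes\mathcal H$ with $\mathrm{Tr}[\rho(\hat n\otimes I)]\le E$, where $\|T\|_1=\mathrm{Tr}\sqrt{T^\dagger T}$. Computations are measured in a model with exact arithmetic: a program is a fixed finite list of instructions with counted loops that acts on natural-number registers (with addition and truncated subtraction) and on arrays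 of complex numbers, and each operation $+,-,\times,\div$, complex conjugation, square root of a non-negative real, zero test, memory access, index operation and loop iteration costs one step. The input of a program consists of $N$, $M$ and the $(N+1)\times(M+1)$ matrix $(\langle i|U|j\rangle)_{i\le N,\,j\le M}$ of $\Pi_NU\Pi_M$. Theorem. There are a constant $C>0$ and two programs $P$, $P'$ such that the following holds for every unitary $U$ on $\mathcal H$ with $U\mathcal S\subseteq\mathcal S$, every $E\ge 0$ and every $\epsilon>0$. Put $M=\lfloor 64E/\epsilon^2\rfloor$. Then $E_U(64E/\epsilon^2)<\infty$, and there are $N\in\mathbb N$ with $$N\le C\,\frac{\max(E,\epsilon^2)}{\epsilon^4}\,E_U\!\left(\frac{64E}{\epsilon^2}\right)$$ (so $N=\mathcal O\big(\frac{E}{\epsilon^4}E_U(\frac{64E}{\epsilon^2})\big)$ for $E\ge\epsilon^2$) and a unitary operator $V_N$ on $\mathcal H_N$ such that: 1. for every unitary operator $V'$ on $\mathcal H_N^\perp$, with $V=V_N\oplus V'$, $\mathcal U=U\cdot U^\dagger$ and $\mathcal V=V\cdot V^\dagger$, one has $\|\mathcal U-\mathcal V\|_\diamond^E\le\epsilon$;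 2. $V_N$ is the unitary factor of a QR factorization of $\Pi_NU\Pi_M$: the matrix of $\Pi_NU\Pi_M$ equals $V_NR$ with $R$ an upper triangular $(N+1)\times(M+1)$ matrix with non-negative real diagonal entries; 3. on the input $(N,M,\Pi_NU\Pi_M)$ the program $P$ outputs $V_N$ in factored form, that is, vectors $w_0,\dots,w_M\in\mathbb C^{N+1}$ and scalars $\tau_0,\dots,\tau_M$ with $V_N=\prod_{k=0}^{M}(I-\tau_kw_kw_k^\dagger)$ (ordered product), in at most $C(N+1)\max(E,\epsilon^2)^2/\epsilon^4$ steps; if moreover $\epsilon^2\le E$ and $\epsilon\le 2$, the number of steps is at most $C\frac{E^3}{\epsilon^8}E_U(\frac{64E}{\epsilon^2})$; 4. on the same input the program $P'$ outputs all $(N+1)^2$ Fock-basis matrix entries of $V_N$ in at most $C(N+1)^2\max(E,\epsilon^2)/\epsilon^2$ steps. -/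

import Mathlib

open scoped ENNReal Topology InnerProductSpace

noncomputable section

namespace Bosonic

/-! ### The single-mode Hilbert space -/

/-- The single-mode Hilbert space `ℋ = ℓ²(ℕ, ℂ)`; `ψ n` is the coefficient `⟨n|ψ⟩`. -/
abbrev FockSpace : Type := lp (fun _ : ℕ => ℂ) 2

/-- The Fock basis vector `|n⟩`. -/
def ket (n : ℕ) : FockSpace := lp.single 2 n (1 : ℂ)

/-- `ℋ_N = span {|0⟩, …, |N⟩} = Range Π_N`, the states with at most `N` particles. -/
def fockSubspace (N : ℕ) : Submodule ℂ FockSpace :=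
  Submodule.span ℂ (Set.range fun n : Fin (N + 1) => ket n)

instance (N : ℕ) : FiniteDimensional ℂ (fockSubspace N) :=
  FiniteDimensional.span_of_finite ℂ (Set.finite_range _)

theorem ket_mem_fockSubspace {N : ℕ} (n : Fin (N + 1)) : ket n ∈ fockSubspace N :=
  Submodule.subset_span ⟨n, rfl⟩

/-- The Schwartz space: coefficients decay faster than every power of `n`. -/
def IsSchwartz (ψ : FockSpace) : Prop :=
  ∀ k : ℕ, Filter.Tendsto (fun n : ℕ => ψ n * (n : ℂ) ^ k) Filter.atTop (𝓝 0)

/-- A physical unitary maps Schwartz states to Schwartz states. -/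
def IsPhysical (U : FockSpace ≃ₗᵢ[ℂ] FockSpace) : Prop :=
  ∀ ψ : FockSpace, IsSchwartz ψ → IsSchwartz (U ψ)

/-- The energy `⟨ψ|n̂|ψ⟩ = ∑ n |⟨n|ψ⟩|²`, possibly infinite. -/
def energy (ψ : FockSpace) : ℝ≥0∞ :=
  ∑' n : ℕ, (n : ℝ≥0∞) * ENNReal.ofReal (‖ψ n‖ ^ 2)

/-- `E_U(x)`: the supremum of `⟨ψ|U† n̂ U|ψ⟩` over the unit vectors `ψ` with at most `x` particles
(for real `x ≥ 0` this means at most `⌊x⌋` particles). -/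
def maximalEnergy (U : FockSpace ≃ₗᵢ[ℂ] FockSpace) (x : ℝ) : ℝ≥0∞ :=
  ⨆ ψ : FockSpace, ⨆ _ : ψ ∈ fockSubspace ⌊x⌋₊ ∧ ‖ψ‖ = 1, energy (U ψ)

/-- `U` as a bounded operator. -/
def toOperator (U : FockSpace ≃ₗᵢ[ℂ] FockSpace) : FockSpace →L[ℂ] FockSpace :=
  (U.toContinuousLinearEquiv : FockSpace →L[ℂ] FockSpace)

/-- The operator `V_N ⊕ V'` on `ℋ = ℋ_N ⊕ ℋ_Nᗮ`. -/
def directSum {N : ℕ} (VN : fockSubspace N ≃ₗᵢ[ℂ] fockSubspace N)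
    (V' : (fockSubspace N)ᗮ ≃ₗᵢ[ℂ] (fockSubspace N)ᗮ) : FockSpace →L[ℂ] FockSpace :=
  (fockSubspace N).subtypeL ∘L (VN.toContinuousLinearEquiv : fockSubspace N →L[ℂ] fockSubspace N)
      ∘L (fockSubspace N).orthogonalProjectionOnto
    + (fockSubspace N)ᗮ.subtypeL
      ∘L (V'.toContinuousLinearEquiv : (fockSubspace N)ᗮ →L[ℂ] (fockSubspace N)ᗮ)
      ∘L (fockSubspace N)ᗮ.orthogonalProjectionOnto

/-! ### The energy-constrained diamond norm -/

/-- The Hilbert space tensor product `ℋ ⊗ ℋ'` with `ℋ' = ℓ²(ℕ, ℂ)`, realised as `ℓ²(ℕ, ℋ)`: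
the sequence `(ψ_k)` stands for `∑ ψ_k ⊗ |k⟩`. -/
abbrev BipartiteSpace : Type := lp (fun _ : ℕ => FockSpace) 2

/-- The orthonormal basis vector `|n⟩ ⊗ |k⟩`, for `p = (n, k)`. -/
def ket₂ (p : ℕ × ℕ) : BipartiteSpace := lp.single 2 p.2 (ket p.1)

/-- `A ⊗ I`. -/
def ampliation (A : FockSpace →L[ℂ] FockSpace) : BipartiteSpace →L[ℂ] BipartiteSpace :=
  lp.mapCLM 2 (fun _ : ℕ => A) (norm_nonneg A) (fun _ => le_rfl)

theorem ampliation_apply (A : FockSpace →L[ℂ] FockSpace) (ψ : BipartiteSpace) (k : ℕ) :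
    ampliation A ψ k = A (ψ k) := rfl

/-- The diagonal matrix element `⟨n,k|T|n,k⟩` of a positive operator. -/
def diagonal (T : BipartiteSpace →L[ℂ] BipartiteSpace) (p : ℕ × ℕ) : ℝ≥0∞ :=
  ENNReal.ofReal (RCLike.re ⟪ket₂ p, T (ket₂ p)⟫_ℂ)

/-- The trace of a positive operator, possibly infinite. -/
def positiveTrace (T : BipartiteSpace →L[ℂ] BipartiteSpace) : ℝ≥0∞ :=
  ∑' p : ℕ × ℕ, diagonal T p

/-- `|T| = √(T† T)` for a bounded operator on a Hilbert space. -/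
def operatorAbs {K : Type*} [NormedAddCommGroup K] [InnerProductSpace ℂ K] [CompleteSpace K]
    (T : K →L[ℂ] K) : K →L[ℂ] K :=
  CFC.abs T

/-- The trace norm `‖T‖₁ = Tr √(T† T)`. -/
def traceNorm (T : BipartiteSpace →L[ℂ] BipartiteSpace) : ℝ≥0∞ :=
  positiveTrace (operatorAbs T)

def IsDensityOperator (ρ : BipartiteSpace →L[ℂ] BipartiteSpace) : Prop :=
  ρ.IsPositive ∧ positiveTrace ρ = 1

/-- `Tr[ρ (n̂ ⊗ I)]` for a positive operator `ρ`. -/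
def inputEnergy (ρ : BipartiteSpace →L[ℂ] BipartiteSpace) : ℝ≥0∞ :=
  ∑' p : ℕ × ℕ, (p.1 : ℝ≥0∞) * diagonal ρ p

/-- For the channel `𝒜 = A · A†`, the map `𝒜 ⊗ id : ρ ↦ (A ⊗ I) ρ (A ⊗ I)†`. -/
def ampliatedChannel (A : FockSpace →L[ℂ] FockSpace) :
    (BipartiteSpace →L[ℂ] BipartiteSpace) → (BipartiteSpace →L[ℂ] BipartiteSpace) :=
  fun ρ => ampliation A ∘L ρ ∘L ContinuousLinearMap.adjoint (ampliation A)

/-- The energy-constrained diamond norm `‖ℰ‖_⋄^E`, as a function of `Φ = ℰ ⊗ id`: the supremum of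
`‖Φ ρ‖₁` over the density operators `ρ` with `Tr[ρ (n̂ ⊗ I)] ≤ E`. -/
def ecDiamondNorm (E : ℝ)
    (Φ : (BipartiteSpace →L[ℂ] BipartiteSpace) → (BipartiteSpace →L[ℂ] BipartiteSpace)) : ℝ≥0∞ :=
  ⨆ ρ : BipartiteSpace →L[ℂ] BipartiteSpace,
    ⨆ _ : IsDensityOperator ρ ∧ inputEnergy ρ ≤ ENNReal.ofReal E, traceNorm (Φ ρ)

/-! ### Matrices in the Fock basis and QR factors -/

/-- The matrix of `Π_N U Π_M`: entries `⟨i|U|j⟩`, `i ≤ N`, `j ≤ M`. -/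
def truncation (U : FockSpace ≃ₗᵢ[ℂ] FockSpace) (N M : ℕ) :
    Matrix (Fin (N + 1)) (Fin (M + 1)) ℂ :=
  Matrix.of fun i j => U (ket j) (i : ℕ)

/-- The Fock basis matrix of a unitary operator on `ℋ_N`. -/
def fockMatrix {N : ℕ} (VN : fockSubspace N ≃ₗᵢ[ℂ] fockSubspace N) :
    Matrix (Fin (N + 1)) (Fin (N + 1)) ℂ :=
  Matrix.of fun i j => (VN ⟨ket j, ket_mem_fockSubspace j⟩ : FockSpace) (i : ℕ)

/-- `Q` is the unitary factor of a QR factorization `A = Q R`, with `R` upper triangular and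
with real non-negative diagonal (the normalization of the Gram–Schmidt process). -/
def IsQRFactor {n m : ℕ} (Q : Matrix (Fin n) (Fin n) ℂ) (A : Matrix (Fin n) (Fin m) ℂ) : Prop :=
  Q ∈ Matrix.unitaryGroup (Fin n) ℂ ∧ ∃ R : Matrix (Fin n) (Fin m) ℂ, A = Q * R ∧
    (∀ (i : Fin n) (j : Fin m), (j : ℕ) < (i : ℕ) → R i j = 0) ∧
    (∀ (i : Fin n) (j : Fin m), (i : ℕ) = (j : ℕ) → 0 ≤ (R i j).re ∧ (R i j).im = 0)

/-! ### A machine model with exact scalar arithmetic and a step count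

Programs act on natural-number registers (used for loop counters and addresses) and on
two-dimensional arrays of complex scalars. Every node of an expression and every executed
instruction costs one step. -/

/-- The memory of the machine: `reg x` is a register, `mem a i j` is entry `(i, j)` of array `a`. -/
structure Store where
  reg : ℕ → ℕ
  mem : ℕ → ℕ → ℕ → ℂ

def Store.setReg (s : Store) (x v : ℕ) : Store :=
  { s with reg := fun y => if y = x then v else s.reg y }

def Store.setMem (s : Store) (a i j : ℕ) (z : ℂ) : Store :=
  { s with mem := fun b k l => if b = a ∧ k = i ∧ l = j then z else s.mem b k l }

/-- Index expressions; `sub` is truncated subtraction. -/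
inductive IndexExpr where
  | const (n : ℕ)
  | var (x : ℕ)
  | add (e f : IndexExpr)
  | sub (e f : IndexExpr)

def IndexExpr.eval (s : Store) : IndexExpr → ℕ
  | const n => n
  | var x => s.reg x
  | add e f => e.eval s + f.eval s
  | sub e f => e.eval s - f.eval s

def IndexExpr.size : IndexExpr → ℕ
  | const _ => 1
  | var _ => 1
  | add e f => e.size + f.size + 1
  | sub e f => e.size + f.size + 1

/-- Scalar expressions; division by zero returns zero, and `sqrt` is the square root of a
non-negative real number (applied to the real part). -/
inductive ScalarExpr where
  | const (n : ℕ)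
  | read (a : ℕ) (i j : IndexExpr)
  | add (e f : ScalarExpr)
  | sub (e f : ScalarExpr)
  | mul (e f : ScalarExpr)
  | div (e f : ScalarExpr)
  | conj (e : ScalarExpr)
  | sqrt (e : ScalarExpr)

def ScalarExpr.eval (s : Store) : ScalarExpr → ℂ
  | const n => (n : ℂ)
  | read a i j => s.mem a (i.eval s) (j.eval s)
  | add e f => e.eval s + f.eval s
  | sub e f => e.eval s - f.eval s
  | mul e f => e.eval s * f.eval s
  | div e f => e.eval s / f.eval s
  | conj e => star (e.eval s)
  | sqrt e => (Real.sqrt (e.eval s).re : ℂ)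

def ScalarExpr.size : ScalarExpr → ℕ
  | const _ => 1
  | read _ i j => i.size + j.size + 1
  | add e f => e.size + f.size + 1
  | sub e f => e.size + f.size + 1
  | mul e f => e.size + f.size + 1
  | div e f => e.size + f.size + 1
  | conj e => e.size + 1
  | sqrt e => e.size + 1

/-- Programs: register assignment, storing a scalar at an array position, sequencing, a zero test,
and counted loops (`loop x e c` runs `c` for `x = 0, …, e - 1`, with `e` evaluated once). -/
inductive Program where
  | assign (x : ℕ) (e : IndexExpr)
  | store (a : ℕ) (i j : IndexExpr) (e : ScalarExpr)
  | seq (c d : Program)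
  | ifZero (e : ScalarExpr) (c d : Program)
  | loop (x : ℕ) (e : IndexExpr) (c : Program)

/-- Run `f 0`, …, `f (n - 1)` in this order, adding up the steps and one step per iteration. -/
def iterate (f : ℕ → Store → Store × ℕ) : ℕ → Store → Store × ℕ
  | 0, s => (s, 0)
  | n + 1, s =>
    ((f n (iterate f n s).1).1, (iterate f n s).2 + (f n (iterate f n s).1).2 + 1)

/-- The final memory and the number of steps of a program. -/
def Program.exec : Program → Store → Store × ℕ
  | assign x e, s => (s.setReg x (e.eval s), e.size + 1)
  | store a i j e, s =>
    (s.setMem a (i.eval s) (j.eval s) (e.eval s), i.size + j.size + e.size + 1)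
  | seq c d, s => ((d.exec (c.exec s).1).1, (c.exec s).2 + (d.exec (c.exec s).1).2)
  | ifZero e c d, s =>
    if e.eval s = 0 then ((c.exec s).1, (c.exec s).2 + e.size + 1)
    else ((d.exec s).1, (d.exec s).2 + e.size + 1)
  | loop x e c, s =>
    ((iterate (fun k t => c.exec (t.setReg x k)) (e.eval s) s).1,
      (iterate (fun k t => c.exec (t.setReg x k)) (e.eval s) s).2 + e.size + 1)

/-- The initial memory: `N` in register 0, `M` in register 1, the matrix `A` in array 0, and zero
everywhere else. -/
def inputStore {N M : ℕ} (A : Matrix (Fin (N + 1)) (Fin (M + 1)) ℂ) : Store where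
  reg x := if x = 0 then N else if x = 1 then M else 0
  mem a i j := if h : a = 0 ∧ i < N + 1 ∧ j < M + 1 then A ⟨i, h.2.1⟩ ⟨j, h.2.2⟩ else 0

/-- Output of a matrix by its entries: array 1 holds the matrix. -/
def Store.outputMatrix (s : Store) (n : ℕ) : Matrix (Fin n) (Fin n) ℂ :=
  Matrix.of fun i j => s.mem 1 i j

/-- Output of a unitary matrix in factored form, as the ordered product of the `m` Householder
factors `I - τ_k w_k w_k†`, `k = 0, …, m - 1`: column `k` of array 1 holds `w_k`, and entry `(k, 0)`
of array 2 holds `τ_k`. -/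
def Store.outputReflectors (s : Store) (n m : ℕ) : Matrix (Fin n) (Fin n) ℂ :=
  ((List.range m).map fun k =>
    (1 : Matrix (Fin n) (Fin n) ℂ) - s.mem 2 k 0 •
      Matrix.vecMulVec (fun i : Fin n => s.mem 1 i k) (fun i : Fin n => star (s.mem 1 i k))).prod

/-- Final memory of `P` on input `(N, M, A)`. -/
def Program.output (P : Program) {N M : ℕ} (A : Matrix (Fin (N + 1)) (Fin (M + 1)) ℂ) : Store :=
  (P.exec (inputStore A)).1

/-- Number of steps of `P` on input `(N, M, A)`. -/
def Program.time (P : Program) {N M : ℕ} (A : Matrix (Fin (N + 1)) (Fin (M + 1)) ℂ) : ℕ :=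
  (P.exec (inputStore A)).2

end Bosonic

end

open Bosonic

namespace Bosonic

/-! ### Parseval identities -/

/-! Put x = 64E/ε², M = ⌊x⌋, e = E_U(x), δ = e/(N+1). Markov's inequality for the number operator
shows that U maps ℋ_M almost into ℋ_N: the matrix A of Π_N U Π_M satisfies ‖Ay‖² ≥ (1-δ)‖y‖²
(`le_sum_norm_sq_truncation_mulVec`). If A = QR, then R satisfies the same bound, and triangularity
turns it into |R_jj|² ≥ 1-δ (`le_norm_sq_diag_of_upper_triangular`). But R_jj is the overlap of V|j⟩
with U|j⟩, a real number in [0,1], so ‖(U-V)|j⟩‖² = 2 - 2R_jj ≤ 2δ (`norm_sq_sub_directSum_ket_le`).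
The completion V' plays no role, since only columns j ≤ M ≤ N are compared.

With D = U - V, summing these M+1 columns bounds D on ℋ_M. Above M, Markov's inequality for the
input energy is used together with ‖D‖ ≤ 2. Hence ‖Dφ‖² ≤ a‖φ‖² + b⟨n̂⟩
(`ofReal_norm_sq_le_of_columns`). For ρ = σ² the difference of the outputs is Uσ(Dσ)† + Dσ(Vσ)†,
whose trace norm is at most 2‖Dσ‖ in Hilbert–Schmidt norm by Hölder's inequality
(`traceNorm_le_of_eq_add`), and ‖Dσ‖² ≤ a + bE ≤ (ε/2)² (`ecDiamondNorm_sub_le`).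

The computation is Householder QR. Its correctness is the loop invariant `FactorInvariant`: product
of the reflectors so far times the current array equals the input. With K = min(N,M)+1 reflectors,
factoring costs O((N+1)K²) and multiplying them out costs O((N+1)²K). -/

theorem tsum_ofReal_norm_sq {G : ℕ → Type*} [∀ i, NormedAddCommGroup (G i)] (f : lp G 2) :
    ∑' i, ENNReal.ofReal (‖f i‖ ^ 2) = ENNReal.ofReal (‖f‖ ^ 2) := by
  have h := lp.hasSum_norm (p := 2) (by norm_num) f
  simp only [ENNReal.toReal_ofNat, Real.rpow_two] at h
  rw [← h.tsum_eq, ENNReal.ofReal_tsum_of_nonneg (fun i => sq_nonneg _) h.summable]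

theorem inner_ket (n : ℕ) (ψ : FockSpace) : ⟪ket n, ψ⟫_ℂ = ψ n := by
  simp [ket, lp.inner_single_left]

theorem inner_ket₂ (p : ℕ × ℕ) (ψ : BipartiteSpace) : ⟪ket₂ p, ψ⟫_ℂ = ψ p.2 p.1 := by
  rw [ket₂, lp.inner_single_left, inner_ket]

theorem norm_ket (n : ℕ) : ‖ket n‖ = 1 := by
  rw [ket, lp.norm_single (by norm_num), norm_one]

theorem norm_ket₂ (p : ℕ × ℕ) : ‖ket₂ p‖ = 1 := by
  rw [ket₂, lp.norm_single (by norm_num), norm_ket]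

theorem tsum_ofReal_norm_inner_ket₂_sq (ψ : BipartiteSpace) :
    ∑' p, ENNReal.ofReal (‖⟪ket₂ p, ψ⟫_ℂ‖ ^ 2) = ENNReal.ofReal (‖ψ‖ ^ 2) := by
  simp_rw [inner_ket₂]
  rw [ENNReal.tsum_prod', ENNReal.tsum_comm, ← tsum_ofReal_norm_sq ψ]
  exact tsum_congr fun k => tsum_ofReal_norm_sq (ψ k)

/-! ### Hilbert–Schmidt norm and trace norm -/

/-- The squared Hilbert–Schmidt norm. -/
noncomputable def hilbertSchmidtSq (X : BipartiteSpace →L[ℂ] BipartiteSpace) : ℝ≥0∞ :=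
  ∑' p, ENNReal.ofReal (‖X (ket₂ p)‖ ^ 2)

/-- Both sides sum the weighted squared matrix elements of X, by columns and by rows. The weight 1
gives invariance of the Hilbert–Schmidt norm under adjoints; the weight q ↦ q.1 gives the energy
identity. -/
theorem tsum_mul_norm_sq_comm (X : BipartiteSpace →L[ℂ] BipartiteSpace) (c : ℕ × ℕ → ℝ≥0∞) :
    ∑' p, ∑' q, c q * ENNReal.ofReal (‖⟪ket₂ q, X (ket₂ p)⟫_ℂ‖ ^ 2) =
      ∑' q, c q * ENNReal.ofReal (‖ContinuousLinearMap.adjoint X (ket₂ q)‖ ^ 2) := by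
  rw [ENNReal.tsum_comm]
  refine tsum_congr fun q => ?_
  rw [ENNReal.tsum_mul_left, ← tsum_ofReal_norm_inner_ket₂_sq]
  congr 1
  refine tsum_congr fun p => ?_
  rw [ContinuousLinearMap.adjoint_inner_right, norm_inner_symm]

theorem hilbertSchmidtSq_adjoint (X : BipartiteSpace →L[ℂ] BipartiteSpace) :
    hilbertSchmidtSq (ContinuousLinearMap.adjoint X) = hilbertSchmidtSq X := by
  have h := tsum_mul_norm_sq_comm X 1
  simp only [Pi.one_apply, one_mul, tsum_ofReal_norm_inner_ket₂_sq] at h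
  exact h.symm

theorem hilbertSchmidtSq_comp_le {S X : BipartiteSpace →L[ℂ] BipartiteSpace}
    (hS : ∀ ψ, ‖S ψ‖ ≤ ‖ψ‖) : hilbertSchmidtSq (S ∘L X) ≤ hilbertSchmidtSq X := by
  refine ENNReal.tsum_le_tsum fun p => ENNReal.ofReal_le_ofReal ?_
  exact pow_le_pow_left₀ (norm_nonneg _) (hS _) 2

theorem sum_norm_sq_le_of_hilbertSchmidtSq_le {X : BipartiteSpace →L[ℂ] BipartiteSpace} {x : ℝ}
    (hX : hilbertSchmidtSq X ≤ ENNReal.ofReal (x ^ 2)) (F : Finset (ℕ × ℕ)) :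
    ∑ p ∈ F, ‖X (ket₂ p)‖ ^ 2 ≤ x ^ 2 := by
  rw [← ENNReal.ofReal_le_ofReal_iff (sq_nonneg x),
    ENNReal.ofReal_sum_of_nonneg fun p _ => sq_nonneg _]
  exact (ENNReal.sum_le_tsum F).trans hX

/-- Each term is an overlap of (SX)†|p⟩ with Y†|p⟩, so Cauchy–Schwarz applies first in the Hilbert
space and then over p. Passing to adjoints does not change the Hilbert–Schmidt norms. -/
theorem sum_norm_inner_le {X Y S : BipartiteSpace →L[ℂ] BipartiteSpace} {x y : ℝ}
    (hx : 0 ≤ x) (hy : 0 ≤ y) (hS : ∀ ψ, ‖S ψ‖ ≤ ‖ψ‖)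
    (hX : hilbertSchmidtSq X ≤ ENNReal.ofReal (x ^ 2))
    (hY : hilbertSchmidtSq Y ≤ ENNReal.ofReal (y ^ 2)) (F : Finset (ℕ × ℕ)) :
    ∑ p ∈ F, ‖⟪ket₂ p, S (X (ContinuousLinearMap.adjoint Y (ket₂ p)))⟫_ℂ‖ ≤ x * y := by
  have h1 := sum_norm_sq_le_of_hilbertSchmidtSq_le (x := x)
    (X := ContinuousLinearMap.adjoint (S ∘L X))
    (by rw [hilbertSchmidtSq_adjoint]; exact (hilbertSchmidtSq_comp_le hS).trans hX) F
  have h2 := sum_norm_sq_le_of_hilbertSchmidtSq_le (x := y) (X := ContinuousLinearMap.adjoint Y)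
    (by rwa [hilbertSchmidtSq_adjoint]) F
  calc ∑ p ∈ F, ‖⟪ket₂ p, S (X (ContinuousLinearMap.adjoint Y (ket₂ p)))⟫_ℂ‖
      ≤ ∑ p ∈ F, ‖ContinuousLinearMap.adjoint (S ∘L X) (ket₂ p)‖ *
          ‖ContinuousLinearMap.adjoint Y (ket₂ p)‖ := by
        refine Finset.sum_le_sum fun p _ => ?_
        have := ContinuousLinearMap.adjoint_inner_left (S ∘L X)
          (ContinuousLinearMap.adjoint Y (ket₂ p)) (ket₂ p)
        rw [ContinuousLinearMap.comp_apply] at this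
        rw [← this]
        exact norm_inner_le_norm _ _
    _ ≤ √(∑ p ∈ F, ‖ContinuousLinearMap.adjoint (S ∘L X) (ket₂ p)‖ ^ 2) *
          √(∑ p ∈ F, ‖ContinuousLinearMap.adjoint Y (ket₂ p)‖ ^ 2) :=
        Real.sum_mul_le_sqrt_mul_sqrt _ _ _
    _ ≤ x * y := by
        gcongr
        · exact Real.sqrt_le_iff.2 ⟨hx, h1⟩
        · exact Real.sqrt_le_iff.2 ⟨hy, h2⟩

/-- A self-adjoint operator has a contractive approximate sign. -/
theorem exists_contraction_approx_abs {K : Type*} [NormedAddCommGroup K] [InnerProductSpace ℂ K]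
    [CompleteSpace K] {T : K →L[ℂ] K} (hT : IsSelfAdjoint T) {η : ℝ} (hη : 0 < η) :
    ∃ S : K →L[ℂ] K, (∀ ψ, ‖S ψ‖ ≤ ‖ψ‖) ∧
      ‖operatorAbs T - S ∘L T‖ ≤ η := by
  -- The sign function is discontinuous, so the continuous functional calculus is applied to
  -- t/(|t|+η) instead; the error |t| - t²/(|t|+η) = |t|η/(|t|+η) is at most η.
  have hpos : ∀ t : ℝ, 0 < |t| + η := fun t => by positivity
  have hc : Continuous fun t : ℝ => t / (|t| + η) :=
    continuous_id.div (by fun_prop) fun t => (hpos t).ne'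
  refine ⟨cfc (fun t : ℝ => t / (|t| + η)) T, fun ψ => ?_, ?_⟩
  · refine (ContinuousLinearMap.le_of_opNorm_le _ (norm_cfc_le zero_le_one fun t _ => ?_) ψ).trans
      (one_mul _).le
    rw [norm_div, Real.norm_eq_abs, Real.norm_eq_abs, abs_of_pos (hpos t), div_le_one (hpos t)]
    linarith
  · have h1 : cfc (fun t : ℝ => t / (|t| + η)) T ∘L T =
        cfc (fun t : ℝ => t / (|t| + η) * t) T := by
      rw [cfc_mul (fun t : ℝ => t / (|t| + η)) (fun t => t) T hc.continuousOn
        continuous_id.continuousOn, cfc_id' ℝ T]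
      rfl
    rw [operatorAbs, CFC.abs_eq_cfc_norm T hT, h1, ← cfc_sub (fun t : ℝ => ‖t‖)
      (fun t : ℝ => t / (|t| + η) * t) T continuous_norm.continuousOn
      (hc.mul continuous_id).continuousOn]
    refine norm_cfc_le hη.le fun t _ => ?_
    have h2 : ‖t‖ - t / (|t| + η) * t = |t| * η / (|t| + η) := by
      rw [Real.norm_eq_abs]
      field_simp [(hpos t).ne']
      nlinarith [sq_abs t]
    rw [h2, Real.norm_eq_abs, abs_of_nonneg (by positivity), div_le_iff₀ (hpos t)]
    nlinarith [abs_nonneg t]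

theorem operatorAbs_isPositive {K : Type*} [NormedAddCommGroup K] [InnerProductSpace ℂ K]
    [CompleteSpace K] (T : K →L[ℂ] K) : (operatorAbs T).IsPositive :=
  (ContinuousLinearMap.nonneg_iff_isPositive _).1 (CFC.abs_nonneg T)

/-- Hölder's inequality ‖X₁Y₁† + X₂Y₂†‖₁ ≤ x₁y₁ + x₂y₂. Writing |T| ≈ ST with a contraction S
replaces the polar decomposition. -/
theorem traceNorm_le_of_eq_add {T X₁ Y₁ X₂ Y₂ : BipartiteSpace →L[ℂ] BipartiteSpace}
    {x₁ y₁ x₂ y₂ : ℝ} (hT : IsSelfAdjoint T)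
    (hTe : T = X₁ ∘L ContinuousLinearMap.adjoint Y₁ + X₂ ∘L ContinuousLinearMap.adjoint Y₂)
    (hx₁ : 0 ≤ x₁) (hy₁ : 0 ≤ y₁) (hx₂ : 0 ≤ x₂) (hy₂ : 0 ≤ y₂)
    (hX₁ : hilbertSchmidtSq X₁ ≤ ENNReal.ofReal (x₁ ^ 2))
    (hY₁ : hilbertSchmidtSq Y₁ ≤ ENNReal.ofReal (y₁ ^ 2))
    (hX₂ : hilbertSchmidtSq X₂ ≤ ENNReal.ofReal (x₂ ^ 2))
    (hY₂ : hilbertSchmidtSq Y₂ ≤ ENNReal.ofReal (y₂ ^ 2)) :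
    traceNorm T ≤ ENNReal.ofReal (x₁ * y₁ + x₂ * y₂) := by
  have habs := operatorAbs_isPositive T
  rw [traceNorm, positiveTrace, ENNReal.tsum_eq_iSup_sum]
  refine iSup_le fun F => ?_
  simp only [diagonal]
  rw [← ENNReal.ofReal_sum_of_nonneg fun p _ => by
    simpa using habs.re_inner_nonneg_right (ket₂ p)]
  refine ENNReal.ofReal_le_ofReal ?_
  refine le_of_forall_pos_le_add fun c hc => ?_
  -- Only a finite partial sum of the trace is estimated, so an operator-norm error of c/(|F|+1)
  -- costs at most c in total.
  obtain ⟨S, hS, hST⟩ := exists_contraction_approx_abs hT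
    (η := c / (F.card + 1)) (by positivity)
  have key : ∀ p ∈ F, RCLike.re ⟪ket₂ p, operatorAbs T (ket₂ p)⟫_ℂ ≤
      (‖⟪ket₂ p, S (X₁ (ContinuousLinearMap.adjoint Y₁ (ket₂ p)))⟫_ℂ‖ +
      ‖⟪ket₂ p, S (X₂ (ContinuousLinearMap.adjoint Y₂ (ket₂ p)))⟫_ℂ‖) + c / (F.card + 1) := by
    intro p _
    have e : operatorAbs T (ket₂ p) =
        (S (X₁ (ContinuousLinearMap.adjoint Y₁ (ket₂ p))) +
          S (X₂ (ContinuousLinearMap.adjoint Y₂ (ket₂ p)))) +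
          (operatorAbs T - S ∘L T) (ket₂ p) := by
      conv_rhs => rw [sub_apply, ContinuousLinearMap.comp_apply]
      rw [← map_add]
      have : T (ket₂ p) = X₁ (ContinuousLinearMap.adjoint Y₁ (ket₂ p)) +
          X₂ (ContinuousLinearMap.adjoint Y₂ (ket₂ p)) := by
        conv_lhs => rw [hTe]
        rfl
      rw [← this]
      abel
    rw [e, inner_add_right, inner_add_right]
    refine (RCLike.re_le_norm _).trans ((norm_add_le _ _).trans (add_le_add (norm_add_le _ _) ?_))
    refine (norm_inner_le_norm _ _).trans ?_
    rw [norm_ket₂, one_mul]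
    simpa [norm_ket₂] using ContinuousLinearMap.le_of_opNorm_le _ hST (ket₂ p)
  refine (Finset.sum_le_sum key).trans ?_
  rw [Finset.sum_add_distrib, Finset.sum_add_distrib, Finset.sum_const, nsmul_eq_mul]
  have h3 : (F.card : ℝ) * (c / (F.card + 1)) ≤ c := by
    rw [mul_div_assoc', div_le_iff₀ (by positivity)]
    nlinarith
  have := sum_norm_inner_le hx₁ hy₁ hS hX₁ hY₁ F
  have := sum_norm_inner_le hx₂ hy₂ hS hX₂ hY₂ F
  linarith

/-! ### Bounding the energy-constrained diamond norm -/

theorem exists_isSelfAdjoint_comp_self {K : Type*} [NormedAddCommGroup K] [InnerProductSpace ℂ K]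
    [CompleteSpace K] {ρ : K →L[ℂ] K} (hρ : ρ.IsPositive) :
    ∃ σ : K →L[ℂ] K, IsSelfAdjoint σ ∧ ρ = σ ∘L σ := by
  have h0 : 0 ≤ ρ := (ContinuousLinearMap.nonneg_iff_isPositive ρ).2 hρ
  exact ⟨CFC.sqrt ρ, (CFC.sqrt_nonneg ρ).isSelfAdjoint, (CFC.sqrt_mul_sqrt_self ρ h0).symm⟩

theorem diagonal_comp_self {σ : BipartiteSpace →L[ℂ] BipartiteSpace} (hσ : IsSelfAdjoint σ)
    (p : ℕ × ℕ) : diagonal (σ ∘L σ) p = ENNReal.ofReal (‖σ (ket₂ p)‖ ^ 2) := by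
  have h := ContinuousLinearMap.adjoint_inner_left σ (σ (ket₂ p)) (ket₂ p)
  rw [← ContinuousLinearMap.star_eq_adjoint, hσ.star_eq] at h
  rw [diagonal, ContinuousLinearMap.comp_apply, ← h, inner_self_eq_norm_sq]

theorem hilbertSchmidtSq_eq_positiveTrace {σ : BipartiteSpace →L[ℂ] BipartiteSpace}
    (hσ : IsSelfAdjoint σ) : hilbertSchmidtSq σ = positiveTrace (σ ∘L σ) :=
  tsum_congr fun p => (diagonal_comp_self hσ p).symm

theorem norm_sq_ampliation (A : FockSpace →L[ℂ] FockSpace) (ψ : BipartiteSpace) :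
    ENNReal.ofReal (‖ampliation A ψ‖ ^ 2) = ∑' k, ENNReal.ofReal (‖A (ψ k)‖ ^ 2) :=
  (tsum_ofReal_norm_sq (ampliation A ψ)).symm

theorem norm_ampliation_le {A : FockSpace →L[ℂ] FockSpace} (hA : ∀ φ, ‖A φ‖ ≤ ‖φ‖)
    (ψ : BipartiteSpace) : ‖ampliation A ψ‖ ≤ ‖ψ‖ := by
  refine le_of_sq_le_sq ?_ (norm_nonneg _)
  rw [← ENNReal.ofReal_le_ofReal_iff (sq_nonneg _), norm_sq_ampliation, ← tsum_ofReal_norm_sq ψ]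
  exact ENNReal.tsum_le_tsum fun k =>
    ENNReal.ofReal_le_ofReal (pow_le_pow_left₀ (norm_nonneg _) (hA _) 2)

theorem ampliation_sub (A B : FockSpace →L[ℂ] FockSpace) :
    ampliation (A - B) = ampliation A - ampliation B := by
  ext ψ k n
  rfl

/-- The total input energy of `σ²` is the sum of the energies of the columns of `σ`. -/
theorem tsum_energy_eq_inputEnergy {σ : BipartiteSpace →L[ℂ] BipartiteSpace}
    (hσ : IsSelfAdjoint σ) :
    ∑' p, ∑' k, energy (σ (ket₂ p) k) = inputEnergy (σ ∘L σ) := by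
  have h := tsum_mul_norm_sq_comm σ fun q => (q.1 : ℝ≥0∞)
  rw [← ContinuousLinearMap.star_eq_adjoint, hσ.star_eq] at h
  simp_rw [inputEnergy, diagonal_comp_self hσ]
  rw [← h]
  refine tsum_congr fun p => ?_
  rw [ENNReal.tsum_prod', ENNReal.tsum_comm]
  refine tsum_congr fun k => tsum_congr fun n => ?_
  rw [inner_ket₂]

/-- D ⊗ I acts on each component of σ|p⟩ separately, so a bound for single-mode vectors that is
linear in squared norm and energy can be summed over components and over p. -/
theorem hilbertSchmidtSq_ampliation_comp_le {σ : BipartiteSpace →L[ℂ] BipartiteSpace}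
    (hσ : IsSelfAdjoint σ) {D : FockSpace →L[ℂ] FockSpace} {a b : ℝ≥0∞}
    (hD : ∀ φ, ENNReal.ofReal (‖D φ‖ ^ 2) ≤ a * ENNReal.ofReal (‖φ‖ ^ 2) + b * energy φ) :
    hilbertSchmidtSq (ampliation D ∘L σ) ≤
      a * positiveTrace (σ ∘L σ) + b * inputEnergy (σ ∘L σ) := by
  rw [← hilbertSchmidtSq_eq_positiveTrace hσ, ← tsum_energy_eq_inputEnergy hσ, hilbertSchmidtSq,
    hilbertSchmidtSq, ← ENNReal.tsum_mul_left, ← ENNReal.tsum_mul_left, ← ENNReal.tsum_add]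
  refine ENNReal.tsum_le_tsum fun p => ?_
  rw [ContinuousLinearMap.comp_apply, norm_sq_ampliation, ← tsum_ofReal_norm_sq (σ (ket₂ p)),
    ← ENNReal.tsum_mul_left, ← ENNReal.tsum_mul_left, ← ENNReal.tsum_add]
  exact ENNReal.tsum_le_tsum fun k => hD _

theorem ampliatedChannel_comp_self {σ : BipartiteSpace →L[ℂ] BipartiteSpace}
    (hσ : IsSelfAdjoint σ) (A : FockSpace →L[ℂ] FockSpace) :
    ampliatedChannel A (σ ∘L σ) =
      (ampliation A ∘L σ) ∘L ContinuousLinearMap.adjoint (ampliation A ∘L σ) := by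
  rw [ContinuousLinearMap.adjoint_comp, ← ContinuousLinearMap.star_eq_adjoint σ, hσ.star_eq]
  rfl

theorem isSelfAdjoint_comp_adjoint (X : BipartiteSpace →L[ℂ] BipartiteSpace) :
    IsSelfAdjoint (X ∘L ContinuousLinearMap.adjoint X) :=
  IsSelfAdjoint.mul_star_self X

theorem hilbertSchmidtSq_ampliation_comp_le_one {σ : BipartiteSpace →L[ℂ] BipartiteSpace}
    (hσ : IsSelfAdjoint σ) (htr : positiveTrace (σ ∘L σ) = 1) {A : FockSpace →L[ℂ] FockSpace}
    (hA : ∀ φ, ‖A φ‖ ≤ ‖φ‖) :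
    hilbertSchmidtSq (ampliation A ∘L σ) ≤ ENNReal.ofReal (1 ^ 2) := by
  refine (hilbertSchmidtSq_comp_le (norm_ampliation_le hA)).trans ?_
  rw [hilbertSchmidtSq_eq_positiveTrace hσ, htr]
  simp

/-- Settles ε ≥ 2, where the chosen N need not exceed M. -/
theorem ecDiamondNorm_sub_le_two {A B : FockSpace →L[ℂ] FockSpace} (hA : ∀ φ, ‖A φ‖ ≤ ‖φ‖)
    (hB : ∀ φ, ‖B φ‖ ≤ ‖φ‖) (E : ℝ) :
    ecDiamondNorm E (ampliatedChannel A - ampliatedChannel B) ≤ ENNReal.ofReal 2 := by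
  refine iSup₂_le fun ρ hρ => ?_
  obtain ⟨⟨hpos, htr⟩, -⟩ := hρ
  obtain ⟨σ, hσ, rfl⟩ := exists_isSelfAdjoint_comp_self hpos
  have h1 := hilbertSchmidtSq_ampliation_comp_le_one hσ htr hA
  have h2 := hilbertSchmidtSq_ampliation_comp_le_one hσ htr hB
  have hneg : hilbertSchmidtSq (-(ampliation B ∘L σ)) ≤ ENNReal.ofReal (1 ^ 2) := by
    refine le_trans (le_of_eq ?_) h2
    exact tsum_congr fun p => by rw [neg_apply, norm_neg]
  rw [Pi.sub_apply, ampliatedChannel_comp_self hσ, ampliatedChannel_comp_self hσ]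
  refine (traceNorm_le_of_eq_add ((isSelfAdjoint_comp_adjoint _).sub
    (isSelfAdjoint_comp_adjoint _)) (X₁ := ampliation A ∘L σ) (Y₁ := ampliation A ∘L σ)
    (X₂ := -(ampliation B ∘L σ)) (Y₂ := ampliation B ∘L σ) ?_ zero_le_one zero_le_one
    zero_le_one zero_le_one h1 h1 hneg h2).trans (ENNReal.ofReal_le_ofReal (by norm_num))
  rw [ContinuousLinearMap.neg_comp, sub_eq_add_neg]

/-- With D = A - B the output difference telescopes as Aσ(Dσ)† + Dσ(Bσ)†; each summand contributes
at most 1 · ε/2. -/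
theorem ecDiamondNorm_sub_le {A B : FockSpace →L[ℂ] FockSpace} (hA : ∀ φ, ‖A φ‖ ≤ ‖φ‖)
    (hB : ∀ φ, ‖B φ‖ ≤ ‖φ‖) {a b E ε : ℝ} (ha : 0 ≤ a) (hb : 0 ≤ b) (hE : 0 ≤ E) (hε : 0 ≤ ε)
    (hAB : ∀ φ, ENNReal.ofReal (‖(A - B) φ‖ ^ 2) ≤
      ENNReal.ofReal a * ENNReal.ofReal (‖φ‖ ^ 2) + ENNReal.ofReal b * energy φ)
    (hab : a + b * E ≤ (ε / 2) ^ 2) :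
    ecDiamondNorm E (ampliatedChannel A - ampliatedChannel B) ≤ ENNReal.ofReal ε := by
  refine iSup₂_le fun ρ hρ => ?_
  obtain ⟨⟨hpos, htr⟩, hen⟩ := hρ
  obtain ⟨σ, hσ, rfl⟩ := exists_isSelfAdjoint_comp_self hpos
  have h1 := hilbertSchmidtSq_ampliation_comp_le_one hσ htr hA
  have h2 := hilbertSchmidtSq_ampliation_comp_le_one hσ htr hB
  have h3 : hilbertSchmidtSq (ampliation (A - B) ∘L σ) ≤ ENNReal.ofReal ((ε / 2) ^ 2) := by
    refine (hilbertSchmidtSq_ampliation_comp_le hσ hAB).trans ?_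
    rw [htr, mul_one]
    refine le_trans ?_ (ENNReal.ofReal_le_ofReal hab)
    rw [ENNReal.ofReal_add ha (mul_nonneg hb hE), ENNReal.ofReal_mul hb]
    gcongr
  rw [Pi.sub_apply, ampliatedChannel_comp_self hσ, ampliatedChannel_comp_self hσ]
  refine (traceNorm_le_of_eq_add ((isSelfAdjoint_comp_adjoint _).sub
    (isSelfAdjoint_comp_adjoint _)) (X₁ := ampliation A ∘L σ) (Y₁ := ampliation (A - B) ∘L σ)
    (X₂ := ampliation (A - B) ∘L σ) (Y₂ := ampliation B ∘L σ) ?_ zero_le_one (by positivity)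
    (by positivity) zero_le_one h1 h3 h3 h2).trans (ENNReal.ofReal_le_ofReal (by linarith))
  rw [ampliation_sub, ContinuousLinearMap.sub_comp, map_sub, ContinuousLinearMap.comp_sub,
    ContinuousLinearMap.sub_comp]
  abel

/-! ### Finite combinations of Fock states -/

theorem ket_apply (n i : ℕ) : ket n i = if i = n then 1 else 0 := by
  rw [ket, lp.single_apply]
  split_ifs with h
  · subst h; simp
  · simp [h]

theorem orthonormal_ket : Orthonormal ℂ ket := by
  rw [orthonormal_iff_ite]
  intro i j
  rw [inner_ket, ket_apply]

/-- The vector `∑ x_j |j⟩` with finitely many coefficients. -/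
noncomputable def fockVector {n : ℕ} (x : Fin n → ℂ) : FockSpace := ∑ j, x j • ket j

theorem fockVector_apply {n : ℕ} (x : Fin n → ℂ) (i : Fin n) : fockVector x i = x i := by
  rw [← inner_ket, fockVector, inner_sum]
  simp [inner_smul_right, inner_ket, ket_apply, Fin.val_inj]

theorem norm_sq_fockVector {n : ℕ} (x : Fin n → ℂ) : ‖fockVector x‖ ^ 2 = ∑ j, ‖x j‖ ^ 2 := by
  have ho : Orthonormal ℂ fun j : Fin n => ket j := orthonormal_ket.comp _ Fin.val_injective
  have h := ho.inner_sum x x Finset.univ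
  rw [← fockVector, inner_self_eq_norm_sq_to_K] at h
  simp only [RCLike.conj_mul] at h
  exact_mod_cast h

theorem fockVector_mem {N : ℕ} (x : Fin (N + 1) → ℂ) : fockVector x ∈ fockSubspace N :=
  Submodule.sum_mem _ fun j _ => Submodule.smul_mem _ _ (ket_mem_fockSubspace j)

theorem exists_eq_fockVector {N : ℕ} {ψ : FockSpace} (hψ : ψ ∈ fockSubspace N) :
    ∃ x : Fin (N + 1) → ℂ, ψ = fockVector x := by
  obtain ⟨x, hx⟩ := (Submodule.mem_span_range_iff_exists_fun ℂ).1 hψ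
  exact ⟨x, hx.symm⟩

theorem norm_sq_fockVector_pos {n : ℕ} {x : Fin n → ℂ} (hx : x ≠ 0) : 0 < ‖fockVector x‖ ^ 2 := by
  obtain ⟨j, hj⟩ := Function.ne_iff.1 hx
  rw [norm_sq_fockVector]
  exact Finset.sum_pos' (fun _ _ => sq_nonneg _)
    ⟨j, Finset.mem_univ _, pow_pos (norm_pos_iff.2 hj) 2⟩

theorem truncation_mulVec (U : FockSpace ≃ₗᵢ[ℂ] FockSpace) (N M : ℕ) (x : Fin (M + 1) → ℂ)
    (i : Fin (N + 1)) : (truncation U N M).mulVec x i = U (fockVector x) i := by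
  rw [← inner_ket, fockVector, map_sum, inner_sum]
  simp [Matrix.mulVec, dotProduct, truncation, inner_smul_right, inner_ket, mul_comm]

theorem norm_sum_smul_sq_le {ι V : Type*} [Fintype ι] [SeminormedAddCommGroup V]
    [NormedSpace ℂ V] (x : ι → ℂ) (v : ι → V) :
    ‖∑ j, x j • v j‖ ^ 2 ≤ (∑ j, ‖x j‖ ^ 2) * ∑ j, ‖v j‖ ^ 2 := by
  calc ‖∑ j, x j • v j‖ ^ 2 ≤ (∑ j, ‖x j‖ * ‖v j‖) ^ 2 := by
        gcongr
        exact (norm_sum_le _ _).trans (Finset.sum_le_sum fun j _ => (norm_smul _ _).le)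
    _ ≤ _ := Finset.sum_mul_sq_le_sq_mul_sq _ _ _

/-! ### Finiteness of the maximal energy -/

theorem isSchwartz_ket (j : ℕ) : IsSchwartz (ket j) := by
  intro k
  refine tendsto_const_nhds.congr' ?_
  filter_upwards [Filter.eventually_gt_atTop j] with n hn
  rw [ket_apply, if_neg hn.ne', zero_mul]

theorem IsSchwartz.energy_lt_top {ψ : FockSpace} (hψ : IsSchwartz ψ) : energy ψ < ⊤ := by
  -- Decay of order n⁻² already suffices: n|ψ_n|² ≤ C²/n³ ≤ C²/n² for n ≥ 1.
  obtain ⟨C, hC⟩ := (hψ 2).norm.bddAbove_range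
  have hC' : ∀ n : ℕ, ‖ψ n‖ * (n : ℝ) ^ 2 ≤ C := fun n => by
    simpa using hC (Set.mem_range_self n)
  have hs : Summable fun n : ℕ => (n : ℝ) * ‖ψ n‖ ^ 2 := by
    refine Summable.of_nonneg_of_le (fun n => by positivity) (fun n => ?_)
      ((Real.summable_one_div_nat_pow.2 one_lt_two).mul_left (C ^ 2))
    rcases Nat.eq_zero_or_pos n with rfl | hn
    · simp
    · have hn' : (1 : ℝ) ≤ n := by exact_mod_cast hn
      rw [mul_one_div, le_div_iff₀ (by positivity)]
      calc (n : ℝ) * ‖ψ n‖ ^ 2 * n ^ 2 = ‖ψ n‖ ^ 2 * (n : ℝ) ^ 3 := by ring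
        _ ≤ ‖ψ n‖ ^ 2 * (n : ℝ) ^ 4 := by gcongr; norm_num
        _ = (‖ψ n‖ * (n : ℝ) ^ 2) ^ 2 := by ring
        _ ≤ C ^ 2 := pow_le_pow_left₀ (by positivity) (hC' n) 2
  have he : energy ψ = ∑' n : ℕ, ENNReal.ofReal ((n : ℝ) * ‖ψ n‖ ^ 2) :=
    tsum_congr fun n => by rw [ENNReal.ofReal_mul (Nat.cast_nonneg n), ENNReal.ofReal_natCast]
  rw [he]
  exact hs.tsum_ofReal_lt_top

theorem energy_sum_smul_le {n : ℕ} (x : Fin n → ℂ) (v : Fin n → FockSpace) :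
    energy (∑ j, x j • v j) ≤ ENNReal.ofReal (∑ j, ‖x j‖ ^ 2) * ∑ j, energy (v j) := by
  simp only [energy]
  rw [← Summable.tsum_finsetSum fun _ _ => ENNReal.summable, ← ENNReal.tsum_mul_left]
  refine ENNReal.tsum_le_tsum fun i => ?_
  have h1 : (∑ j, x j • v j : FockSpace) i = ∑ j, x j • v j i := by
    rw [← inner_ket, inner_sum]
    simp [inner_smul_right, inner_ket]
  rw [h1, ← Finset.mul_sum, ← ENNReal.ofReal_sum_of_nonneg (fun _ _ => sq_nonneg _),
    mul_left_comm, ← ENNReal.ofReal_mul (Finset.sum_nonneg fun _ _ => sq_nonneg _)]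
  gcongr
  exact norm_sum_smul_sq_le _ _

/-- Fock states are Schwartz, so each of the finitely many U|j⟩ has finite energy, and by
Cauchy–Schwarz their sum bounds the energy of the image of any unit vector in their span. -/
theorem IsPhysical.maximalEnergy_lt_top {U : FockSpace ≃ₗᵢ[ℂ] FockSpace} (hU : IsPhysical U)
    (x : ℝ) : maximalEnergy U x < ⊤ := by
  refine lt_of_le_of_lt (b := ∑ j : Fin (⌊x⌋₊ + 1), energy (U (ket j))) ?_
    (ENNReal.sum_lt_top.2 fun j _ => (hU _ (isSchwartz_ket j)).energy_lt_top)
  refine iSup₂_le fun ψ hψ => ?_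
  obtain ⟨y, rfl⟩ := exists_eq_fockVector hψ.1
  have h := energy_sum_smul_le y fun j => U (ket j)
  rw [← norm_sq_fockVector, hψ.2] at h
  rw [fockVector, map_sum]
  simpa using h

theorem energy_smul (c : ℂ) (ψ : FockSpace) :
    energy (c • ψ) = ENNReal.ofReal (‖c‖ ^ 2) * energy ψ := by
  rw [energy, energy, ← ENNReal.tsum_mul_left]
  refine tsum_congr fun n => ?_
  rw [lp.coeFn_smul, Pi.smul_apply, norm_smul, mul_pow, ENNReal.ofReal_mul (sq_nonneg _)]
  ring

theorem energy_apply_le (U : FockSpace ≃ₗᵢ[ℂ] FockSpace) {x : ℝ} {ψ : FockSpace}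
    (hψ : ψ ∈ fockSubspace ⌊x⌋₊) :
    energy (U ψ) ≤ maximalEnergy U x * ENNReal.ofReal (‖ψ‖ ^ 2) := by
  rcases eq_or_ne ψ 0 with rfl | h0
  · simp [energy]
  · have hn : ‖ψ‖ ≠ 0 := norm_ne_zero_iff.2 h0
    set φ : FockSpace := ((‖ψ‖ : ℂ)⁻¹) • ψ with hφ
    have hφ1 : ‖φ‖ = 1 := by simp [hφ, norm_smul, hn]
    have e : ψ = (‖ψ‖ : ℂ) • φ := by
      rw [hφ, smul_smul, mul_inv_cancel₀ (by exact_mod_cast hn), one_smul]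
    have h1 : energy (U φ) ≤ maximalEnergy U x :=
      le_iSup₂_of_le (f := fun (ψ : FockSpace) (_ : ψ ∈ fockSubspace ⌊x⌋₊ ∧ ‖ψ‖ = 1) =>
        energy (U ψ)) φ ⟨Submodule.smul_mem _ _ hψ, hφ1⟩ le_rfl
    have h2 : energy (U ψ) = ENNReal.ofReal (‖ψ‖ ^ 2) * energy (U φ) := by
      conv_lhs => rw [e, map_smul, energy_smul]
      simp
    rw [h2, mul_comm]
    gcongr

/-- Most of the weight of a low-energy vector lies on the first Fock states. -/
theorem norm_sq_le_sum_add_of_energy_le {φ : FockSpace} {c : ℝ} (hc : 0 ≤ c)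
    (h : energy φ ≤ ENNReal.ofReal c) (N : ℕ) :
    ‖φ‖ ^ 2 ≤ ∑ i : Fin (N + 1), ‖φ i‖ ^ 2 + c / (N + 1) := by
  have hN : (0 : ℝ) < N + 1 := by positivity
  -- Markov's inequality: every index beyond the first N+1 weighs at least N+1 in the energy.
  have h1 : ((N : ℝ≥0∞) + 1) * ENNReal.ofReal (‖φ‖ ^ 2) ≤
      (N + 1) * ENNReal.ofReal (∑ i : Fin (N + 1), ‖φ i‖ ^ 2) + energy φ := by
    have split (f : ℕ → ℝ≥0∞) :
        ∑' i, f i = ∑ i ∈ Finset.range (N + 1), f i + ∑' i, f (i + (N + 1)) :=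
      (Summable.sum_add_tsum_nat_add' ENNReal.summable).symm
    rw [Fin.sum_univ_eq_sum_range (fun i => ‖φ i‖ ^ 2), ← tsum_ofReal_norm_sq φ,
      ENNReal.ofReal_sum_of_nonneg (fun _ _ => sq_nonneg _), split, mul_add,
      ← ENNReal.tsum_mul_left]
    gcongr
    rw [energy, split fun n => (n : ℝ≥0∞) * ENNReal.ofReal (‖φ n‖ ^ 2)]
    refine le_add_left (ENNReal.tsum_le_tsum fun i => ?_)
    gcongr
    push_cast
    exact le_add_self
  have h2 : ENNReal.ofReal ((N + 1) * ‖φ‖ ^ 2) ≤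
      ENNReal.ofReal ((N + 1) * ∑ i : Fin (N + 1), ‖φ i‖ ^ 2 + c) := by
    rw [ENNReal.ofReal_add (by positivity) hc, ENNReal.ofReal_mul hN.le, ENNReal.ofReal_mul hN.le,
      ENNReal.ofReal_add (by positivity) zero_le_one, ENNReal.ofReal_natCast, ENNReal.ofReal_one]
    exact h1.trans (by gcongr)
  rw [ENNReal.ofReal_le_ofReal_iff (by positivity)] at h2
  rw [← sub_le_iff_le_add', le_div_iff₀ hN]
  linarith

/-- The image of a vector with at most ⌊x⌋ particles has energy at most E_U(x)‖y‖², so truncation at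
N loses at most the fraction E_U(x)/(N+1) of its squared norm. -/
theorem le_sum_norm_sq_truncation_mulVec (U : FockSpace ≃ₗᵢ[ℂ] FockSpace) {x : ℝ}
    (hU : maximalEnergy U x < ⊤) (N : ℕ) (y : Fin (⌊x⌋₊ + 1) → ℂ) :
    (1 - (maximalEnergy U x).toReal / (N + 1)) * ‖fockVector y‖ ^ 2 ≤
      ∑ i, ‖(truncation U N ⌊x⌋₊).mulVec y i‖ ^ 2 := by
  have h := energy_apply_le U (fockVector_mem y)
  rw [← ENNReal.ofReal_toReal hU.ne, ← ENNReal.ofReal_mul ENNReal.toReal_nonneg] at h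
  have h2 := norm_sq_le_sum_add_of_energy_le (by positivity) h N
  simp_rw [truncation_mulVec]
  rw [LinearIsometryEquiv.norm_map] at h2
  rw [sub_mul, one_mul, div_mul_eq_mul_div]
  linarith

theorem exists_ne_zero_mulVec_eq_zero {n m : ℕ} (A : Matrix (Fin n) (Fin m) ℂ) (h : n < m) :
    ∃ y : Fin m → ℂ, y ≠ 0 ∧ A.mulVec y = 0 := by
  have hk : LinearMap.ker A.mulVecLin ≠ ⊥ := LinearMap.ker_ne_bot_of_finrank_lt (by simpa using h)
  obtain ⟨y, hy, hy0⟩ := (Submodule.ne_bot_iff _).1 hk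
  exact ⟨y, hy0, by simpa using hy⟩

/-- A unitary cannot squeeze `⌊x⌋ + 1` dimensions into fewer Fock states. -/
theorem succ_le_maximalEnergy (U : FockSpace ≃ₗᵢ[ℂ] FockSpace) {x : ℝ}
    (hU : maximalEnergy U x < ⊤) {N : ℕ} (hN : N < ⌊x⌋₊) :
    (N + 1 : ℝ) ≤ (maximalEnergy U x).toReal := by
  -- A kernel vector of the truncation is mapped by U entirely above N, so the lost fraction
  -- E_U(x)/(N+1) must be at least 1.
  obtain ⟨y, hy0, hy⟩ := exists_ne_zero_mulVec_eq_zero (truncation U N ⌊x⌋₊)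
    (Nat.add_lt_add_right hN 1)
  have h := le_sum_norm_sq_truncation_mulVec U hU N y
  rw [hy] at h
  have h1 : 1 - (maximalEnergy U x).toReal / (N + 1) ≤ 0 := by
    by_contra! hc
    have := mul_pos hc (norm_sq_fockVector_pos hy0)
    simp at h
    linarith
  have hN' : (0 : ℝ) < N + 1 := by positivity
  rw [sub_nonpos, le_div_iff₀ hN'] at h1
  linarith

/-! ### Unitary operators on `ℋ_N` from unitary matrices -/

/-- The Fock basis of `ℋ_N`. -/
noncomputable def fockBasis (N : ℕ) : OrthonormalBasis (Fin (N + 1)) ℂ (fockSubspace N) :=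
  OrthonormalBasis.mk (v := fun j => ⟨ket j, ket_mem_fockSubspace j⟩)
    (by
      have ho : Orthonormal ℂ fun j : Fin (N + 1) => ket j :=
        orthonormal_ket.comp _ Fin.val_injective
      rw [orthonormal_iff_ite] at ho ⊢
      exact ho)
    (by
      rintro ⟨ψ, hψ⟩ -
      obtain ⟨x, rfl⟩ := exists_eq_fockVector hψ
      have : (⟨fockVector x, hψ⟩ : fockSubspace N) =
          ∑ j, x j • (⟨ket j, ket_mem_fockSubspace j⟩ : fockSubspace N) := by
        ext1
        simp [fockVector]
      rw [this]
      exact Submodule.sum_mem _ fun j _ =>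
        Submodule.smul_mem _ _ (Submodule.subset_span ⟨j, rfl⟩))

theorem fockBasis_apply {N : ℕ} (j : Fin (N + 1)) :
    fockBasis N j = ⟨ket j, ket_mem_fockSubspace j⟩ := by
  simp [fockBasis]

theorem fockBasis_repr_apply {N : ℕ} (ψ : fockSubspace N) (i : Fin (N + 1)) :
    (fockBasis N).repr ψ i = (ψ : FockSpace) i := by
  rw [OrthonormalBasis.repr_apply_apply, fockBasis_apply, Submodule.coe_inner, inner_ket]

theorem exists_fockMatrix_eq {N : ℕ} {Q : Matrix (Fin (N + 1)) (Fin (N + 1)) ℂ}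
    (hQ : Q ∈ Matrix.unitaryGroup (Fin (N + 1)) ℂ) :
    ∃ VN : fockSubspace N ≃ₗᵢ[ℂ] fockSubspace N, fockMatrix VN = Q := by
  have hL : Matrix.toEuclideanCLM (n := Fin (N + 1)) (𝕜 := ℂ) Q ∈
      unitary (EuclideanSpace ℂ (Fin (N + 1)) →L[ℂ] EuclideanSpace ℂ (Fin (N + 1))) :=
    Unitary.map_mem (Matrix.toEuclideanCLM (n := Fin (N + 1)) (𝕜 := ℂ)) hQ
  refine ⟨((fockBasis N).repr.trans (Unitary.linearIsometryEquiv ⟨_, hL⟩)).trans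
    (fockBasis N).repr.symm, ?_⟩
  ext i j
  rw [fockMatrix, Matrix.of_apply, ← fockBasis_apply, ← fockBasis_repr_apply]
  simp only [LinearIsometryEquiv.trans_apply, LinearIsometryEquiv.apply_symm_apply,
    OrthonormalBasis.repr_self]
  change (Matrix.toEuclideanCLM (n := Fin (N + 1)) (𝕜 := ℂ) Q (EuclideanSpace.single j 1)) i = Q i j
  simp

theorem norm_directSum_apply {N : ℕ} (VN : fockSubspace N ≃ₗᵢ[ℂ] fockSubspace N)
    (V' : (fockSubspace N)ᗮ ≃ₗᵢ[ℂ] (fockSubspace N)ᗮ) (φ : FockSpace) :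
    ‖directSum VN V' φ‖ = ‖φ‖ := by
  have h : ‖directSum VN V' φ‖ ^ 2 = ‖φ‖ ^ 2 := by
    rw [Submodule.norm_sq_eq_add_norm_sq_projection φ (fockSubspace N)]
    have h1 : directSum VN V' φ =
      (VN ((fockSubspace N).orthogonalProjectionOnto φ) : FockSpace) +
        (V' ((fockSubspace N)ᗮ.orthogonalProjectionOnto φ) : FockSpace) := rfl
    have h2 : ⟪(VN ((fockSubspace N).orthogonalProjectionOnto φ) : FockSpace),
        (V' ((fockSubspace N)ᗮ.orthogonalProjectionOnto φ) : FockSpace)⟫_ℂ = 0 :=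
      Submodule.inner_right_of_mem_orthogonal (Subtype.coe_prop _) (Subtype.coe_prop _)
    have h3 := norm_add_sq_eq_norm_sq_add_norm_sq_of_inner_eq_zero _ _ h2
    simp only [← pow_two] at h3
    rw [h1, h3, ← Submodule.coe_norm, ← Submodule.coe_norm, VN.norm_map, V'.norm_map]
  exact (sq_eq_sq₀ (norm_nonneg _) (norm_nonneg _)).1 h

/-- The first N+1 columns do not see V'; this is why every completion approximates equally well. -/
theorem directSum_ket {N : ℕ} (VN : fockSubspace N ≃ₗᵢ[ℂ] fockSubspace N)
    (V' : (fockSubspace N)ᗮ ≃ₗᵢ[ℂ] (fockSubspace N)ᗮ) (j : Fin (N + 1)) :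
    directSum VN V' (ket j) = fockVector fun i => fockMatrix VN i j := by
  have h1 : (fockSubspace N).orthogonalProjectionOnto (ket j) =
      ⟨ket j, ket_mem_fockSubspace j⟩ :=
    Submodule.orthogonalProjectionOnto_mem_subspace_eq_self
      (⟨ket j, ket_mem_fockSubspace j⟩ : fockSubspace N)
  have h2 : (fockSubspace N)ᗮ.orthogonalProjectionOnto (ket j) = 0 :=
    Submodule.orthogonalProjectionOnto_orthogonal_apply_eq_zero
      (ket_mem_fockSubspace j)
  have h3 : directSum VN V' (ket j) =
      (VN ((fockSubspace N).orthogonalProjectionOnto (ket j)) : FockSpace) +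
        (V' ((fockSubspace N)ᗮ.orthogonalProjectionOnto (ket j)) : FockSpace) := rfl
  rw [h3, h1, h2, map_zero, Submodule.coe_zero, add_zero]
  obtain ⟨x, hx⟩ := exists_eq_fockVector (VN ⟨ket j, ket_mem_fockSubspace j⟩).2
  have h4 : (fun i => fockMatrix VN i j) = x := by
    ext i
    rw [fockMatrix, Matrix.of_apply, hx, fockVector_apply]
  rw [h4, hx]

/-! ### Diagonal of the triangular factor -/

theorem sum_norm_sq_mulVec_of_mem_unitaryGroup {n : ℕ} {Q : Matrix (Fin n) (Fin n) ℂ}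
    (hQ : Q ∈ Matrix.unitaryGroup (Fin n) ℂ) (y : Fin n → ℂ) :
    ∑ i, ‖Q.mulVec y i‖ ^ 2 = ∑ i, ‖y i‖ ^ 2 := by
  have hs (z : Fin n → ℂ) : ((∑ i, ‖z i‖ ^ 2 : ℝ) : ℂ) = star z ⬝ᵥ z := by
    simp [dotProduct, RCLike.conj_mul]
  have h : ((∑ i, ‖Q.mulVec y i‖ ^ 2 : ℝ) : ℂ) = ((∑ i, ‖y i‖ ^ 2 : ℝ) : ℂ) := by
    rw [hs, hs, Matrix.star_mulVec, ← Matrix.dotProduct_mulVec, Matrix.mulVec_mulVec,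
      ← Matrix.star_eq_conjTranspose, Matrix.mem_unitaryGroup_iff'.1 hQ, Matrix.one_mulVec]
  exact_mod_cast h

/-- A lower bound for the diagonal of a triangular matrix that almost preserves norms. -/
theorem le_norm_sq_diag_of_upper_triangular {n m : ℕ} {R : Matrix (Fin n) (Fin m) ℂ}
    (hR : ∀ (i : Fin n) (j : Fin m), (j : ℕ) < (i : ℕ) → R i j = 0) {c : ℝ}
    (h : ∀ y : Fin m → ℂ, c * ∑ j, ‖y j‖ ^ 2 ≤ ∑ i, ‖R.mulVec y i‖ ^ 2)
    (j : Fin m) (i : Fin n) (hij : (i : ℕ) = j) : c ≤ ‖R i j‖ ^ 2 := by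
  -- A kernel vector y of B is annihilated by the rows of R above the diagonal position and vanishes
  -- beyond j. Triangularity kills the rows below, so Ry has the single nonzero candidate R_ij y_j.
  -- Row j of B is zero, which makes B singular.
  let B : Matrix (Fin m) (Fin m) ℂ := Matrix.of fun a b =>
    if ha : a < j then R ⟨a, by omega⟩ b else if a = j then 0 else if a = b then 1 else 0
  have hB : B.det = 0 := Matrix.det_eq_zero_of_row_eq_zero j fun b => by simp [B]
  obtain ⟨y, hy0, hy⟩ := Matrix.exists_mulVec_eq_zero_iff.2 hB
  have hy1 : ∀ a, j < a → y a = 0 := fun a ha => by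
    have := congrFun hy a
    simpa [B, Matrix.mulVec, dotProduct, ha.not_gt, ha.ne'] using this
  have hy2 : ∀ a : Fin n, a < i → R.mulVec y a = 0 := fun a ha => by
    have ha' : (a : ℕ) < j := by have := Fin.lt_def.1 ha; omega
    have := congrFun hy ⟨a, by omega⟩
    have hlt : (⟨a, by omega⟩ : Fin m) < j := Fin.lt_def.2 ha'
    simpa [B, Matrix.mulVec, dotProduct, hlt] using this
  have hy3 : ∀ a : Fin n, i < a → R.mulVec y a = 0 := fun a ha => by
    rw [Matrix.mulVec, dotProduct]
    refine Finset.sum_eq_zero fun b _ => ?_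
    rcases lt_or_ge j b with hb | hb
    · rw [hy1 b hb, mul_zero]
    · rw [hR a b (by have := Fin.lt_def.1 ha; have := Fin.le_def.1 hb; omega), zero_mul]
  have hy4 : R.mulVec y i = R i j * y j := by
    rw [Matrix.mulVec, dotProduct]
    refine Finset.sum_eq_single j (fun b _ hb => ?_) fun h => absurd (Finset.mem_univ j) h
    rcases lt_or_gt_of_ne hb with hb | hb
    · rw [hR i b (by have := Fin.lt_def.1 hb; omega), zero_mul]
    · rw [hy1 b hb, mul_zero]
  have hsum : ∑ a, ‖R.mulVec y a‖ ^ 2 = ‖R i j‖ ^ 2 * ‖y j‖ ^ 2 := by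
    rw [Finset.sum_eq_single i (fun a _ ha => ?_) (by simp), hy4, norm_mul, mul_pow]
    rcases lt_or_gt_of_ne ha with ha | ha
    · rw [hy2 a ha]; simp
    · rw [hy3 a ha]; simp
  have hpos : 0 < ∑ b, ‖y b‖ ^ 2 := by
    rw [← norm_sq_fockVector]
    exact norm_sq_fockVector_pos hy0
  refine le_of_mul_le_mul_right ?_ hpos
  refine (h y).trans ?_
  rw [hsum]
  gcongr
  exact Finset.single_le_sum (f := fun b => ‖y b‖ ^ 2) (fun b _ => sq_nonneg _)
    (Finset.mem_univ j)

/-- The columns of the QR factor are close to those of the unitary. -/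
theorem norm_sq_sub_directSum_ket_le (U : FockSpace ≃ₗᵢ[ℂ] FockSpace) {x : ℝ}
    (hU : maximalEnergy U x < ⊤) {N : ℕ} (hN : ⌊x⌋₊ ≤ N)
    {VN : fockSubspace N ≃ₗᵢ[ℂ] fockSubspace N}
    (hQR : IsQRFactor (fockMatrix VN) (truncation U N ⌊x⌋₊))
    (V' : (fockSubspace N)ᗮ ≃ₗᵢ[ℂ] (fockSubspace N)ᗮ) (j : Fin (⌊x⌋₊ + 1)) :
    ‖(toOperator U - directSum VN V') (ket j)‖ ^ 2 ≤
      2 * ((maximalEnergy U x).toReal / (N + 1)) := by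
  obtain ⟨hQ, R, hA, hR, hdiag⟩ := hQR
  set δ := (maximalEnergy U x).toReal / (N + 1) with hδ
  set i : Fin (N + 1) := ⟨j, by omega⟩ with hi
  obtain ⟨hre, him⟩ := hdiag i j rfl
  have hRA : R = star (fockMatrix VN) * truncation U N ⌊x⌋₊ := by
    rw [hA, ← Matrix.mul_assoc, Matrix.mem_unitaryGroup_iff'.1 hQ, Matrix.one_mul]
  have hVj : directSum VN V' (ket j) = fockVector fun a => fockMatrix VN a i :=
    directSum_ket VN V' i
  have hinner : ⟪directSum VN V' (ket j), U (ket j)⟫_ℂ = R i j := by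
    rw [hVj, fockVector, sum_inner, hRA, Matrix.mul_apply]
    refine Finset.sum_congr rfl fun a _ => ?_
    rw [inner_smul_left, inner_ket]
    rfl
  have hVn : ‖directSum VN V' (ket j)‖ = 1 := by rw [norm_directSum_apply, norm_ket]
  have hUn : ‖U (ket j)‖ = 1 := by rw [LinearIsometryEquiv.norm_map, norm_ket]
  have hle : ‖R i j‖ ≤ 1 := by
    rw [← hinner]
    simpa [hVn, hUn] using norm_inner_le_norm (𝕜 := ℂ) (directSum VN V' (ket j)) (U (ket j))
  have hn : ‖R i j‖ = (R i j).re := by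
    have h : R i j = ((R i j).re : ℂ) := by apply Complex.ext <;> simp [him]
    conv_lhs => rw [h]
    rw [Complex.norm_real, Real.norm_of_nonneg hre]
  have hlow : 1 - δ ≤ (R i j).re := by
    have := le_norm_sq_diag_of_upper_triangular hR (c := 1 - δ) (fun y => ?_) j i rfl
    · rw [hn] at this hle
      -- Since 0 ≤ R_jj ≤ 1, the bound on R_jj² passes to R_jj itself.
      nlinarith
    · rw [← sum_norm_sq_mulVec_of_mem_unitaryGroup hQ, Matrix.mulVec_mulVec, ← hA,
        ← norm_sq_fockVector]
      exact le_sum_norm_sq_truncation_mulVec U hU N y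
  have h2 : ‖(toOperator U - directSum VN V') (ket j)‖ ^ 2 = 2 - 2 * (R i j).re := by
    have h3 : (toOperator U - directSum VN V') (ket j) =
      U (ket j) - directSum VN V' (ket j) := rfl
    rw [h3, norm_sub_rev, norm_sub_sq (𝕜 := ℂ), hinner, hVn, hUn]
    change 1 ^ 2 - 2 * (R i j).re + 1 ^ 2 = _
    ring
  rw [h2]
  linarith

/-! ### From columns to energy-constrained errors -/

theorem norm_sq_sub_fockVector (φ : FockSpace) (M : ℕ) :
    ‖φ - fockVector fun j : Fin (M + 1) => φ j‖ ^ 2 =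
      ‖φ‖ ^ 2 - ∑ j : Fin (M + 1), ‖φ j‖ ^ 2 := by
  have hin : ⟪fockVector fun j : Fin (M + 1) => φ j, φ⟫_ℂ =
      ((∑ j : Fin (M + 1), ‖φ j‖ ^ 2 : ℝ) : ℂ) := by
    rw [fockVector, sum_inner]
    simp [inner_smul_left, inner_ket, RCLike.conj_mul]
  rw [norm_sub_rev, norm_sub_sq (𝕜 := ℂ), hin, norm_sq_fockVector, RCLike.re_to_complex,
    Complex.ofReal_re]
  ring

/-- Split φ at level M. Cauchy–Schwarz over the columns controls the head; the tail has squared norm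
at most energy/(M+1) and D at most doubles norms. Then (s+2t)² ≤ 2s² + 8t² gives the constants. -/
theorem ofReal_norm_sq_le_of_columns {D : FockSpace →L[ℂ] FockSpace} (hD : ∀ φ, ‖D φ‖ ≤ 2 * ‖φ‖)
    {M : ℕ} {c : ℝ} (hc : ∑ j : Fin (M + 1), ‖D (ket j)‖ ^ 2 ≤ c) (φ : FockSpace) :
    ENNReal.ofReal (‖D φ‖ ^ 2) ≤ ENNReal.ofReal (2 * c) * ENNReal.ofReal (‖φ‖ ^ 2) +
      ENNReal.ofReal (8 / (M + 1)) * energy φ := by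
  have hc0 : 0 ≤ c := le_trans (Finset.sum_nonneg fun _ _ => sq_nonneg _) hc
  rcases eq_or_ne (energy φ) ⊤ with he | he
  -- At infinite energy the right side is infinite because 8/(M+1) is nonzero.
  · rw [he, ENNReal.mul_top (by rw [ENNReal.ofReal_ne_zero_iff]; positivity)]
    simp
  · set e := (energy φ).toReal with hee
    have he0 : 0 ≤ e := ENNReal.toReal_nonneg
    have hen : energy φ = ENNReal.ofReal e := (ENNReal.ofReal_toReal he).symm
    rw [hen, ← ENNReal.ofReal_mul (by positivity), ← ENNReal.ofReal_mul (by positivity),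
      ← ENNReal.ofReal_add (by positivity) (by positivity)]
    refine ENNReal.ofReal_le_ofReal ?_
    set y : Fin (M + 1) → ℂ := fun j => φ j with hy
    have htail := norm_sq_le_sum_add_of_energy_le he0 hen.le M
    have hsub := norm_sq_sub_fockVector φ M
    have hrest : ‖φ - fockVector y‖ ^ 2 ≤ e / (M + 1) := by linarith
    have hhead : ‖D (fockVector y)‖ ^ 2 ≤ ‖φ‖ ^ 2 * c := by
      have hDy : D (fockVector y) = ∑ j, y j • D (ket j) := by
        rw [fockVector, map_sum]
        exact Finset.sum_congr rfl fun j _ => D.map_smul _ _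
      rw [hDy]
      refine (norm_sum_smul_sq_le y fun j => D (ket j)).trans ?_
      refine mul_le_mul ?_ hc (Finset.sum_nonneg fun _ _ => sq_nonneg _) (sq_nonneg _)
      linarith [sq_nonneg ‖φ - fockVector y‖]
    have hsplit : D φ = D (fockVector y) + D (φ - fockVector y) := by
      rw [← map_add, add_sub_cancel]
    have h1 : ‖D φ‖ ≤ ‖D (fockVector y)‖ + 2 * ‖φ - fockVector y‖ := by
      rw [hsplit]
      exact (norm_add_le _ _).trans (by gcongr; exact hD _)
    calc ‖D φ‖ ^ 2 ≤ (‖D (fockVector y)‖ + 2 * ‖φ - fockVector y‖) ^ 2 := by gcongr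
      _ ≤ 2 * ‖D (fockVector y)‖ ^ 2 + 8 * ‖φ - fockVector y‖ ^ 2 := by
        nlinarith [sq_nonneg (‖D (fockVector y)‖ - 2 * ‖φ - fockVector y‖)]
      _ ≤ 2 * (‖φ‖ ^ 2 * c) + 8 * (e / (M + 1)) := by gcongr
      _ = 2 * c * ‖φ‖ ^ 2 + 8 / (M + 1) * e := by ring

/-- Any completion of the QR factor approximates the unitary. -/
theorem ecDiamondNorm_sub_directSum_le (U : FockSpace ≃ₗᵢ[ℂ] FockSpace) {E ε : ℝ} (hE : 0 ≤ E)
    (hε : 0 < ε) (hU : maximalEnergy U (64 * E / ε ^ 2) < ⊤) {N : ℕ}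
    (hN : 32 * (⌊64 * E / ε ^ 2⌋₊ + 1) * (maximalEnergy U (64 * E / ε ^ 2)).toReal / ε ^ 2 ≤ N + 1)
    {VN : fockSubspace N ≃ₗᵢ[ℂ] fockSubspace N}
    (hQR : IsQRFactor (fockMatrix VN) (truncation U N ⌊64 * E / ε ^ 2⌋₊))
    (V' : (fockSubspace N)ᗮ ≃ₗᵢ[ℂ] (fockSubspace N)ᗮ) :
    ecDiamondNorm E (ampliatedChannel (toOperator U) - ampliatedChannel (directSum VN V'))
      ≤ ENNReal.ofReal ε := by
  have hUn : ∀ φ, ‖toOperator U φ‖ ≤ ‖φ‖ := fun φ => (U.norm_map φ).le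
  have hVn : ∀ φ, ‖directSum VN V' φ‖ ≤ ‖φ‖ := fun φ => (norm_directSum_apply VN V' φ).le
  rcases le_or_gt 2 ε with h2 | h2
  · exact (ecDiamondNorm_sub_le_two hUn hVn E).trans (ENNReal.ofReal_le_ofReal h2)
  set M := ⌊64 * E / ε ^ 2⌋₊ with hM
  set e := (maximalEnergy U (64 * E / ε ^ 2)).toReal with he
  have hε2 : 0 < ε ^ 2 := by positivity
  have hMlt : 64 * E / ε ^ 2 < M + 1 := Nat.lt_floor_add_one _
  rw [div_le_iff₀ hε2] at hN
  rw [div_lt_iff₀ hε2] at hMlt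
  have hM0 : (0 : ℝ) ≤ M := Nat.cast_nonneg _
  have hN0 : (0 : ℝ) ≤ N := Nat.cast_nonneg _
  have he0 : 0 ≤ e := ENNReal.toReal_nonneg
  -- If N < M, dimension counting gives e ≥ N+1, whereas `hN` with ε² < 4 gives 32(M+1)e ≤ 4(N+1).
  have hMN : M ≤ N := by
    by_contra! hc
    have h1 := succ_le_maximalEnergy U hU hc
    have h3 : (N + 1 : ℝ) * ε ^ 2 ≤ (N + 1) * 4 := by gcongr; nlinarith
    nlinarith [mul_nonneg hM0 he0]
  -- The sum is at most (M+1) · 2e/(N+1), and `hN` is exactly the condition that this be at most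
  -- ε²/16.
  have hcol : ∑ j : Fin (M + 1), ‖(toOperator U - directSum VN V') (ket j)‖ ^ 2 ≤ ε ^ 2 / 16 := by
    refine (Finset.sum_le_sum fun j _ =>
      norm_sq_sub_directSum_ket_le U hU hMN hQR V' j).trans ?_
    rw [Finset.sum_const, Finset.card_univ, Fintype.card_fin, nsmul_eq_mul]
    push_cast
    rw [← he, ← mul_div_assoc, ← mul_div_assoc, div_le_div_iff₀ (by positivity) (by norm_num)]
    linarith
  -- The budget (ε/2)² is shared equally: a = ε²/8 from the columns, and bE ≤ ε²/8 because 64E <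
  -- (M+1)ε².
  refine ecDiamondNorm_sub_le hUn hVn (a := 2 * (ε ^ 2 / 16)) (b := 8 / (M + 1)) (by positivity)
    (by positivity) hE hε.le (ofReal_norm_sq_le_of_columns (fun φ => ?_) hcol) ?_
  · have : (toOperator U - directSum VN V') φ = toOperator U φ - directSum VN V' φ := rfl
    rw [this]
    refine (norm_sub_le _ _).trans ?_
    linarith [hUn φ, hVn φ]
  · have : 8 / (M + 1) * E ≤ ε ^ 2 / 8 := by
      rw [div_mul_eq_mul_div, div_le_div_iff₀ (by positivity) (by norm_num)]
      linarith
    linarith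

/-! ### Householder reflectors -/

/-- The elementary reflector `I - τ w w†`. -/
def reflector {n : ℕ} (τ : ℂ) (w : Fin n → ℂ) : Matrix (Fin n) (Fin n) ℂ :=
  1 - τ • Matrix.vecMulVec w (star w)

theorem star_reflector {n : ℕ} (τ : ℂ) (w : Fin n → ℂ) :
    star (reflector τ w) = reflector (star τ) w := by
  simp [reflector, Matrix.star_eq_conjTranspose, Matrix.conjTranspose_vecMulVec]

/-- As (ww†)² = (w†w) ww†, the product with the adjoint is I minus a multiple of ww†; the hypothesis
says that the multiple is zero. -/
theorem reflector_mem_unitaryGroup {n : ℕ} {τ : ℂ} {w : Fin n → ℂ}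
    (h : τ + star τ = τ * star τ * (star w ⬝ᵥ w)) :
    reflector τ w ∈ Matrix.unitaryGroup (Fin n) ℂ := by
  rw [Matrix.mem_unitaryGroup_iff, star_reflector, reflector, reflector]
  have hv : Matrix.vecMulVec w (star w) * Matrix.vecMulVec w (star w) =
      (star w ⬝ᵥ w) • Matrix.vecMulVec w (star w) := by
    rw [Matrix.vecMulVec_mul_vecMulVec, Matrix.vecMulVec_smul]
  have : (1 - τ • Matrix.vecMulVec w (star w)) * (1 - star τ • Matrix.vecMulVec w (star w)) =
      1 - (τ + star τ - τ * star τ * (star w ⬝ᵥ w)) • Matrix.vecMulVec w (star w) := by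
    rw [sub_mul, mul_sub, mul_sub, smul_mul_smul_comm, hv]
    simp only [mul_one, one_mul, smul_smul, sub_smul, add_smul, mul_assoc]
    abel
  rw [this, h, sub_self, zero_smul, sub_zero]

theorem reflector_mulVec {n : ℕ} (τ : ℂ) (w v : Fin n → ℂ) :
    (reflector τ w).mulVec v = fun i => v i - τ * (star w ⬝ᵥ v) * w i := by
  ext i
  rw [reflector, Matrix.sub_mulVec, Matrix.one_mulVec, Matrix.smul_mulVec,
    Matrix.vecMulVec_mulVec]
  simp
  ring

/-- The norm of the entries `k, …, n - 1` of a vector. -/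
noncomputable def tailNorm {n : ℕ} (x : Fin n → ℂ) (k : Fin n) : ℝ :=
  √(∑ i with k ≤ i, ‖x i‖ ^ 2)

/-- The Householder vector that annihilates the entries of `x` below `k`. -/
noncomputable def householderVector {n : ℕ} (x : Fin n → ℂ) (k : Fin n) : Fin n → ℂ :=
  fun i => if i < k then 0 else if i = k then x k - tailNorm x k else x i

/-- The scalar of the Householder reflector; it is zero, by `1 / 0 = 0`, exactly if the entries
below `k` vanish and the entry at `k` is real and non-negative. -/
noncomputable def householderScalar {n : ℕ} (x : Fin n → ℂ) (k : Fin n) : ℂ :=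
  1 / ((tailNorm x k : ℂ) * tailNorm x k - tailNorm x k * star (x k))

theorem tailNorm_sq {n : ℕ} (x : Fin n → ℂ) (k : Fin n) :
    tailNorm x k ^ 2 = ‖x k‖ ^ 2 + ∑ i with k < i, ‖x i‖ ^ 2 := by
  rw [tailNorm, Real.sq_sqrt (Finset.sum_nonneg fun _ _ => sq_nonneg _)]
  have : (Finset.univ.filter fun i => k ≤ i) = insert k (Finset.univ.filter fun i => k < i) := by
    ext i
    simp [le_iff_eq_or_lt, eq_comm]
  rw [this, Finset.sum_insert (by simp)]

theorem star_householderVector_dotProduct {n : ℕ} (x v : Fin n → ℂ) (k : Fin n) :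
    star (householderVector x k) ⬝ᵥ v =
      star (x k - tailNorm x k) * v k + ∑ i with k < i, star (x i) * v i := by
  rw [dotProduct, ← Finset.sum_filter_add_sum_filter_not _ (fun i => k < i), add_comm]
  congr 1
  · rw [Finset.sum_eq_single k]
    · simp [householderVector]
    · intro b hb hbk
      have : b < k := lt_of_le_of_ne (not_lt.1 (Finset.mem_filter.1 hb).2) hbk
      simp [householderVector, this]
    · simp
  · refine Finset.sum_congr rfl fun i hi => ?_
    have hi' : k < i := (Finset.mem_filter.1 hi).2
    simp [householderVector, hi'.not_gt, hi'.ne']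

theorem sum_star_mul_self {n : ℕ} (x : Fin n → ℂ) (k : Fin n) :
    ∑ i with k < i, star (x i) * x i = (tailNorm x k : ℂ) ^ 2 - star (x k) * x k := by
  have h : ((tailNorm x k ^ 2 : ℝ) : ℂ) = ((‖x k‖ ^ 2 + ∑ i with k < i, ‖x i‖ ^ 2 : ℝ) : ℂ) := by
    rw [tailNorm_sq]
  have hx : ∀ z : ℂ, star z * z = (‖z‖ : ℂ) ^ 2 := fun z => RCLike.conj_mul z
  simp_rw [hx]
  push_cast at h
  rw [h]
  ring

theorem star_householderVector_dotProduct_self {n : ℕ} (x : Fin n → ℂ) (k : Fin n) :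
    star (householderVector x k) ⬝ᵥ x = (tailNorm x k : ℂ) * tailNorm x k - tailNorm x k * x k := by
  rw [star_householderVector_dotProduct, sum_star_mul_self]
  simp
  ring

theorem star_householderVector_dotProduct_householderVector {n : ℕ} (x : Fin n → ℂ) (k : Fin n) :
    star (householderVector x k) ⬝ᵥ householderVector x k =
      2 * (tailNorm x k : ℂ) * tailNorm x k - tailNorm x k * x k - tailNorm x k * star (x k) := by
  rw [star_householderVector_dotProduct]
  have h : ∑ i with k < i, star (x i) * householderVector x k i =
      ∑ i with k < i, star (x i) * x i :=
    Finset.sum_congr rfl fun i hi => by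
      have hi' : k < i := (Finset.mem_filter.1 hi).2
      simp [householderVector, hi'.not_gt, hi'.ne']
  rw [h, sum_star_mul_self]
  simp [householderVector]
  ring

/-- With d the denominator of τ, w†w = d + d̄, so τ = 1/d satisfies the unitarity condition, and so
does τ = 0 when d = 0. A complex τ is what allows a non-real x_k to be sent to a non-negative entry.
-/
theorem householder_mem_unitaryGroup {n : ℕ} (x : Fin n → ℂ) (k : Fin n) :
    reflector (householderScalar x k) (householderVector x k) ∈
      Matrix.unitaryGroup (Fin n) ℂ := by
  apply reflector_mem_unitaryGroup
  rw [star_householderVector_dotProduct_householderVector, householderScalar]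
  set d : ℂ := (tailNorm x k : ℂ) * tailNorm x k - tailNorm x k * star (x k) with hd
  have hs : star d = (tailNorm x k : ℂ) * tailNorm x k - tailNorm x k * x k := by
    simp [hd]
  have he : 2 * (tailNorm x k : ℂ) * tailNorm x k - tailNorm x k * x k -
      tailNorm x k * star (x k) = d + star d := by
    rw [hs, hd]
    ring
  rw [he, star_div₀, star_one]
  rcases eq_or_ne d 0 with h0 | h0
  · simp [h0]
  · have h1 : star d ≠ 0 := star_ne_zero.2 h0
    field_simp
    ring

/-- The adjoint reflector maps `x` to a vector supported on the entries up to `k`, with a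
non-negative entry at `k`. -/
theorem star_householder_mulVec_self {n : ℕ} (x : Fin n → ℂ) (k i : Fin n) :
    (star (reflector (householderScalar x k) (householderVector x k))).mulVec x i =
      if i < k then x i else if i = k then (tailNorm x k : ℂ) else 0 := by
  rw [star_reflector, reflector_mulVec, star_householderVector_dotProduct_self]
  set d : ℂ := (tailNorm x k : ℂ) * tailNorm x k - tailNorm x k * x k with hd
  have hs : star (householderScalar x k) = 1 / d := by
    simp [householderScalar, hd]
  rw [hs]
  -- If d = 0, then x already has the required form and the reflector is the identity. Otherwise w†x
  -- = d and τ̄ = 1/d, so the image is x - w.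
  rcases eq_or_ne d 0 with h0 | h0
  · have hxk : x k = tailNorm x k := by
      rcases mul_eq_zero.1 (show (tailNorm x k : ℂ) * (tailNorm x k - x k) = 0 by
        rw [← h0, hd]; ring) with h | h
      · have hz : tailNorm x k = 0 := by exact_mod_cast h
        have := tailNorm_sq x k
        rw [hz] at this ⊢
        have hn : ‖x k‖ ^ 2 = 0 := by
          have h3 : 0 ≤ ∑ i with k < i, ‖x i‖ ^ 2 := Finset.sum_nonneg fun _ _ => sq_nonneg _
          nlinarith [sq_nonneg ‖x k‖]
        simpa using hn
      · exact (sub_eq_zero.1 h).symm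
    have hrest : ∑ i with k < i, ‖x i‖ ^ 2 = 0 := by
      have := tailNorm_sq x k
      rw [hxk, Complex.norm_real, Real.norm_eq_abs, sq_abs] at this
      linarith
    have hi0 : ∀ i, k < i → x i = 0 := fun i hi => by
      have := (Finset.sum_eq_zero_iff_of_nonneg fun _ _ => sq_nonneg _).1 hrest i (by simpa using hi)
      simpa using this
    simp only [h0, div_zero, zero_mul, sub_zero]
    split_ifs with h1 h2
    · rfl
    · rw [h2, hxk]
    · exact hi0 i (lt_of_le_of_ne (not_lt.1 h1) (Ne.symm h2))
  · simp only [one_div_mul_cancel h0, one_mul, householderVector]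
    split_ifs with h1 h2
    · ring
    · rw [h2]; ring
    · ring

/-- Protects the columns already reduced: they vanish from row k on, where w is supported. -/
theorem star_householder_mulVec_of_eq_zero {n : ℕ} (x v : Fin n → ℂ) (k : Fin n)
    (hv : ∀ i, k ≤ i → v i = 0) :
    (star (reflector (householderScalar x k) (householderVector x k))).mulVec v = v := by
  have h : star (householderVector x k) ⬝ᵥ v = 0 := by
    rw [star_householderVector_dotProduct, hv k le_rfl, Finset.sum_eq_zero fun i hi => ?_]
    · simp
    · rw [hv i (Finset.mem_filter.1 hi).2.le, mul_zero]
  rw [star_reflector, reflector_mulVec, h]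
  simp

/-! ### Reasoning about programs -/

theorem IndexExpr.eval_setMem (s : Store) (a i j : ℕ) (z : ℂ) (e : IndexExpr) :
    e.eval (s.setMem a i j z) = e.eval s := by
  induction e with
  | const n => rfl
  | var x => rfl
  | add e f he hf => simp [IndexExpr.eval, he, hf]
  | sub e f he hf => simp [IndexExpr.eval, he, hf]

/-- The loop rule: an invariant together with a uniform cost bound per iteration, plus one step for
the iteration itself. -/
theorem iterate_spec {f : ℕ → Store → Store × ℕ} {n c : ℕ} {s : Store} (I : ℕ → Store → Prop)
    (h0 : I 0 s) (hstep : ∀ k < n, ∀ t, I k t → I (k + 1) (f k t).1 ∧ (f k t).2 ≤ c) :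
    I n (iterate f n s).1 ∧ (iterate f n s).2 ≤ n * (c + 1) := by
  induction n with
  | zero => exact ⟨h0, by simp [iterate]⟩
  | succ n ih =>
    obtain ⟨h1, h2⟩ := ih fun k hk => hstep k (hk.trans (Nat.lt_succ_self n))
    obtain ⟨h3, h4⟩ := hstep n (Nat.lt_succ_self n) _ h1
    refine ⟨h3, ?_⟩
    simp only [iterate]
    rw [Nat.succ_mul]
    omega

theorem exec_loop_spec {x : ℕ} {e : IndexExpr} {p : Program} {s : Store} {c : ℕ}
    (I : ℕ → Store → Prop) (h0 : I 0 s)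
    (hstep : ∀ k < e.eval s, ∀ t, I k t →
      I (k + 1) (p.exec (t.setReg x k)).1 ∧ (p.exec (t.setReg x k)).2 ≤ c) :
    I (e.eval s) ((Program.loop x e p).exec s).1 ∧
      ((Program.loop x e p).exec s).2 ≤ e.eval s * (c + 1) + e.size + 1 := by
  obtain ⟨h1, h2⟩ := iterate_spec (f := fun k t => p.exec (t.setReg x k)) I h0 hstep
  exact ⟨h1, by simp only [Program.exec]; omega⟩

/-- Sum the scalar `g` over the values `0, …, e - 1` of register 5 into entry `(0, 0)` of the
scratch array 4. -/
def sumLoop (e : IndexExpr) (g : ScalarExpr) : Program :=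
  .seq (.store 4 (.const 0) (.const 0) (.const 0))
    (.loop 5 e (.store 4 (.const 0) (.const 0) (.add (.read 4 (.const 0) (.const 0)) g)))

/-- Registers are nested by loop depth: 0 to 2 hold sizes, 3 the reflector, 4 and 5 the inner loops.
Array 4 is scratch. The hypothesis asks that g depend only on what the loop leaves alone and on
register 5. -/
theorem exec_sumLoop {e : IndexExpr} {g : ScalarExpr} {s : Store} (G : ℕ → ℂ)
    (hg : ∀ t : Store, (∀ y < 5, t.reg y = s.reg y) → (∀ b, b ≠ 4 → t.mem b = s.mem b) →
      g.eval t = G (t.reg 5)) :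
    (∀ y < 5, ((sumLoop e g).exec s).1.reg y = s.reg y) ∧
    (∀ b, b ≠ 4 → ((sumLoop e g).exec s).1.mem b = s.mem b) ∧
    ((sumLoop e g).exec s).1.mem 4 0 0 = ∑ i ∈ Finset.range (e.eval s), G i ∧
    ((sumLoop e g).exec s).2 ≤ e.eval s * (g.size + 8) + e.size + 5 := by
  obtain ⟨⟨h1, h2, h3⟩, h4⟩ := exec_loop_spec (x := 5) (e := e)
    (p := .store 4 (.const 0) (.const 0) (.add (.read 4 (.const 0) (.const 0)) g))
    (s := s.setMem 4 0 0 0) (c := g.size + 7)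
    (fun k t => (∀ y < 5, t.reg y = s.reg y) ∧ (∀ b, b ≠ 4 → t.mem b = s.mem b) ∧
      t.mem 4 0 0 = ∑ i ∈ Finset.range k, G i)
    ⟨fun _ _ => rfl, fun b hb => by ext; simp [Store.setMem, hb], by simp [Store.setMem]⟩
    (by
      rintro k - t ⟨h1, h2, h3⟩
      have hr : ∀ y < 5, (t.setReg 5 k).reg y = s.reg y := fun y hy => by
        simp [Store.setReg, hy.ne, h1 y hy]
      have he := hg (t.setReg 5 k) hr h2
      refine ⟨⟨hr, fun b hb => ?_, ?_⟩, ?_⟩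
      · rw [← h2 b hb]
        ext
        simp [Program.exec, Store.setMem, Store.setReg, hb]
      · rw [Finset.sum_range_succ, ← h3]
        simp only [Program.exec, Store.setMem, ScalarExpr.eval, IndexExpr.eval, he]
        simp [Store.setReg]
      · simp only [Program.exec, ScalarExpr.size, IndexExpr.size]
        omega)
  rw [IndexExpr.eval_setMem] at h3 h4
  have hx : (sumLoop e g).exec s = ((((Program.loop 5 e (.store 4 (.const 0) (.const 0)
      (.add (.read 4 (.const 0) (.const 0)) g))).exec (s.setMem 4 0 0 0)).1),
      4 + ((Program.loop 5 e (.store 4 (.const 0) (.const 0)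
      (.add (.read 4 (.const 0) (.const 0)) g))).exec (s.setMem 4 0 0 0)).2) := by
    simp [sumLoop, Program.exec, ScalarExpr.size, IndexExpr.size, ScalarExpr.eval, IndexExpr.eval]
  rw [hx]
  refine ⟨h1, h2, h3, ?_⟩
  linarith

/-- Store the scalar `g` at the entry `(u, v)` of array `a`, for the values `0, …, e - 1` of
register 5. -/
def updateLoop (a : ℕ) (u v e : IndexExpr) (g : ScalarExpr) : Program :=
  .loop 5 e (.store a u v g)

/-- Injectivity of the addresses means that a cell still holds its initial value when its turn
comes, so g may read the cell it is about to overwrite. -/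
theorem exec_updateLoop {a : ℕ} {u v e : IndexExpr} {g : ScalarExpr} {s : Store}
    (p q : ℕ → ℕ) (G : ℕ → ℂ)
    (hu : ∀ t : Store, (∀ y < 5, t.reg y = s.reg y) → u.eval t = p (t.reg 5))
    (hv : ∀ t : Store, (∀ y < 5, t.reg y = s.reg y) → v.eval t = q (t.reg 5))
    (hinj : ∀ i j, p i = p j → q i = q j → i = j)
    (hg : ∀ t : Store, (∀ y < 5, t.reg y = s.reg y) → (∀ b, b ≠ a → t.mem b = s.mem b) →
      t.mem a (p (t.reg 5)) (q (t.reg 5)) = s.mem a (p (t.reg 5)) (q (t.reg 5)) →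
      g.eval t = G (t.reg 5)) :
    (∀ y < 5, ((updateLoop a u v e g).exec s).1.reg y = s.reg y) ∧
    (∀ b, b ≠ a → ((updateLoop a u v e g).exec s).1.mem b = s.mem b) ∧
    (∀ i < e.eval s, ((updateLoop a u v e g).exec s).1.mem a (p i) (q i) = G i) ∧
    (∀ x y, (∀ i < e.eval s, ¬ (x = p i ∧ y = q i)) →
      ((updateLoop a u v e g).exec s).1.mem a x y = s.mem a x y) ∧
    ((updateLoop a u v e g).exec s).2 ≤
      e.eval s * (u.size + v.size + g.size + 2) + e.size + 1 := by
  obtain ⟨⟨h1, h2, h3, h4⟩, h5⟩ := exec_loop_spec (x := 5) (e := e)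
    (p := .store a u v g) (s := s) (c := u.size + v.size + g.size + 1)
    (fun k t => (∀ y < 5, t.reg y = s.reg y) ∧ (∀ b, b ≠ a → t.mem b = s.mem b) ∧
      (∀ i < k, t.mem a (p i) (q i) = G i) ∧
      (∀ x y, (∀ i < k, ¬ (x = p i ∧ y = q i)) → t.mem a x y = s.mem a x y))
    ⟨fun _ _ => rfl, fun _ _ => rfl, fun i hi => absurd hi (Nat.not_lt_zero i), fun _ _ _ => rfl⟩
    (by
      rintro k - t ⟨h1, h2, h3, h4⟩
      have hr : ∀ y < 5, (t.setReg 5 k).reg y = s.reg y := fun y hy => by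
        simp [Store.setReg, hy.ne, h1 y hy]
      have h5 : (t.setReg 5 k).reg 5 = k := by simp [Store.setReg]
      have he := hg (t.setReg 5 k) hr h2 (by
        rw [h5]
        exact h4 _ _ fun i hi hc => hi.ne' (hinj k i hc.1 hc.2))
      have heu := hu (t.setReg 5 k) hr
      have hev := hv (t.setReg 5 k) hr
      rw [h5] at he heu hev
      have hx : ((Program.store a u v g).exec (t.setReg 5 k)).1 =
          (t.setReg 5 k).setMem a (p k) (q k) (G k) := by
        simp only [Program.exec, he, heu, hev]
      rw [hx]
      refine ⟨⟨hr, fun b hb => ?_, fun i hi => ?_, fun x y hxy => ?_⟩, le_rfl⟩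
      · rw [← h2 b hb]
        ext
        simp [Store.setMem, Store.setReg, hb]
      · rcases Nat.lt_succ_iff_lt_or_eq.1 hi with hi | rfl
        · rw [← h3 i hi]
          have : ¬ (p i = p k ∧ q i = q k) := fun hc => hi.ne (hinj i k hc.1 hc.2)
          simp [Store.setMem, Store.setReg, this]
        · simp [Store.setMem]
      · rw [← h4 x y fun i hi => hxy i (hi.trans (Nat.lt_succ_self k))]
        simp [Store.setMem, Store.setReg, hxy k (Nat.lt_succ_self k)])
  refine ⟨h1, h2, h3, h4, ?_⟩
  exact h5

/-! ### The subroutines of the factorization -/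

/-- The number `N + 1` of rows. -/
def rowCount : IndexExpr := .add (.var 0) (.const 1)

theorem rowCount_eval (s : Store) : rowCount.eval s = s.reg 0 + 1 := rfl

/-- For the values `0, …, e - 1` of register 4, sum `g` over the values `0, …, N` of register 5 into
the scratch array and then store `h` at the entries `(u, v)` of array `b`, again for the values
`0, …, N` of register 5. -/
def rankOneLoop (b : ℕ) (u v e : IndexExpr) (g h : ScalarExpr) : Program :=
  .loop 4 e (.seq (sumLoop rowCount g) (updateLoop b u v rowCount h))

/-- An in-place rank-one update. The addresses are abstract so that one proof covers the left
action, column by column, and the right action, row by row; slices not yet reached are unchanged. -/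
theorem exec_rankOneLoop {b : ℕ} {u v e : IndexExpr} {g h : ScalarExpr} {s : Store}
    (hb : b ≠ 4) (p q : ℕ → ℕ → ℕ) (G : ℕ → ℕ → ℂ) (H : ℕ → ℕ → ℂ → ℂ)
    (hu : ∀ t : Store, (∀ y < 4, t.reg y = s.reg y) → u.eval t = p (t.reg 5) (t.reg 4))
    (hv : ∀ t : Store, (∀ y < 4, t.reg y = s.reg y) → v.eval t = q (t.reg 5) (t.reg 4))
    (hinj : ∀ i j i' j', p i j = p i' j' → q i j = q i' j' → i = i' ∧ j = j')
    (hg : ∀ t : Store, (∀ y < 4, t.reg y = s.reg y) →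
      (∀ c, c ≠ b → c ≠ 4 → t.mem c = s.mem c) →
      (∀ i, t.mem b (p i (t.reg 4)) (q i (t.reg 4)) = s.mem b (p i (t.reg 4)) (q i (t.reg 4))) →
      g.eval t = G (t.reg 5) (t.reg 4))
    (hh : ∀ t : Store, (∀ y < 4, t.reg y = s.reg y) →
      (∀ c, c ≠ b → c ≠ 4 → t.mem c = s.mem c) →
      t.mem b (p (t.reg 5) (t.reg 4)) (q (t.reg 5) (t.reg 4)) =
        s.mem b (p (t.reg 5) (t.reg 4)) (q (t.reg 5) (t.reg 4)) →
      h.eval t = H (t.reg 5) (t.reg 4) (t.mem 4 0 0)) :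
    (∀ y < 4, ((rankOneLoop b u v e g h).exec s).1.reg y = s.reg y) ∧
    (∀ c, c ≠ b → c ≠ 4 → ((rankOneLoop b u v e g h).exec s).1.mem c = s.mem c) ∧
    (∀ i < s.reg 0 + 1, ∀ j < e.eval s,
      ((rankOneLoop b u v e g h).exec s).1.mem b (p i j) (q i j) =
        H i j (∑ l ∈ Finset.range (s.reg 0 + 1), G l j)) ∧
    ((rankOneLoop b u v e g h).exec s).2 ≤ e.eval s *
      ((s.reg 0 + 1) * (g.size + u.size + v.size + h.size + 23)) + e.size + 1 := by
  obtain ⟨⟨h1, h2, h3, -⟩, h5⟩ := exec_loop_spec (x := 4) (e := e)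
    (p := .seq (sumLoop rowCount g) (updateLoop b u v rowCount h)) (s := s)
    (c := (s.reg 0 + 1) * (g.size + u.size + v.size + h.size + 22))
    (fun k t => (∀ y < 4, t.reg y = s.reg y) ∧
      (∀ c, c ≠ b → c ≠ 4 → t.mem c = s.mem c) ∧
      (∀ i < s.reg 0 + 1, ∀ j < k, t.mem b (p i j) (q i j) =
        H i j (∑ l ∈ Finset.range (s.reg 0 + 1), G l j)) ∧
      (∀ i j, k ≤ j → t.mem b (p i j) (q i j) = s.mem b (p i j) (q i j)))
    ⟨fun _ _ => rfl, fun _ _ _ => rfl, fun i _ j hj => absurd hj (Nat.not_lt_zero j),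
      fun _ _ _ => rfl⟩
    (by
      rintro k - t ⟨h1, h2, h3, h4⟩
      set t₁ := t.setReg 4 k with ht₁
      have hr₁ : ∀ y < 4, t₁.reg y = s.reg y := fun y hy => by
        simp [ht₁, Store.setReg, hy.ne, h1 y hy]
      have hk₁ : t₁.reg 4 = k := by simp [ht₁, Store.setReg]
      obtain ⟨a1, a2, a3, a4⟩ := exec_sumLoop (e := rowCount) (g := g) (s := t₁)
        (fun i => G i k) (by
          intro t' ht' hm'
          have e4 : t'.reg 4 = k := (ht' 4 (by norm_num)).trans hk₁
          rw [hg t' (fun y hy => (ht' y (by omega)).trans (hr₁ y hy))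
            (fun c hc hc' => (hm' c hc').trans (h2 c hc hc')) (fun i => ?_), e4]
          rw [e4, hm' b hb]
          exact h4 i k le_rfl)
      set t₂ := ((sumLoop rowCount g).exec t₁).1 with ht₂
      have hr₂ : ∀ y < 4, t₂.reg y = s.reg y := fun y hy =>
        (a1 y (by omega)).trans (hr₁ y hy)
      have hk₂ : t₂.reg 4 = k := (a1 4 (by norm_num)).trans hk₁
      obtain ⟨b1, b2, b3, b4, b5⟩ := exec_updateLoop (a := b) (u := u) (v := v) (e := rowCount)
        (g := h) (s := t₂) (fun i => p i k) (fun i => q i k)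
        (fun i => H i k (t₂.mem 4 0 0))
        (fun t' ht' => by
          rw [hu t' fun y hy => (ht' y (by omega)).trans (hr₂ y hy), ht' 4 (by norm_num), hk₂])
        (fun t' ht' => by
          rw [hv t' fun y hy => (ht' y (by omega)).trans (hr₂ y hy), ht' 4 (by norm_num), hk₂])
        (fun i j hp hq => (hinj i k j k hp hq).1)
        (fun t' ht' hm' hc' => by
          have e4 : t'.reg 4 = k := (ht' 4 (by norm_num)).trans hk₂
          have e4' : t'.mem 4 0 0 = t₂.mem 4 0 0 := by rw [hm' 4 hb.symm]
          rw [hh t' (fun y hy => (ht' y (by omega)).trans (hr₂ y hy))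
            (fun c hc hc' => (hm' c hc).trans ((a2 c hc').trans (h2 c hc hc'))) ?_, e4, e4']
          rw [e4, hc', a2 b hb]
          exact h4 _ k le_rfl)
      have hn₁ : rowCount.eval t₁ = s.reg 0 + 1 := by rw [rowCount_eval, hr₁ 0 (by norm_num)]
      have hn₂ : rowCount.eval t₂ = s.reg 0 + 1 := by rw [rowCount_eval, hr₂ 0 (by norm_num)]
      rw [hn₁] at a3 a4
      rw [hn₂] at b3 b4 b5
      refine ⟨⟨fun y hy => (b1 y (by omega)).trans (hr₂ y hy),
        fun c hc hc' => (b2 c hc).trans ((a2 c hc').trans (h2 c hc hc')), fun i hi j hj => ?_,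
        fun i j hj => ?_⟩, ?_⟩
      · rcases Nat.lt_succ_iff_lt_or_eq.1 hj with hj | rfl
        · rw [← h3 i hi j hj]
          refine (b4 _ _ fun i' _ hc => hj.ne (hinj _ _ _ _ hc.1 hc.2).2).trans ?_
          rw [a2 b hb]
          rfl
        · rw [← a3]
          exact b3 i hi
      · rw [← h4 i j (by omega)]
        refine (b4 _ _ fun i' _ hc => ?_).trans (by rw [a2 b hb]; rfl)
        have := (hinj _ _ _ _ hc.1 hc.2).2
        omega
      · have hs : rowCount.size = 3 := rfl
        rw [hs] at a4 b5
        have hpos : 1 ≤ s.reg 0 + 1 := by omega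
        have hx : ((Program.seq (sumLoop rowCount g) (updateLoop b u v rowCount h)).exec t₁).2 =
          ((sumLoop rowCount g).exec t₁).2 + ((updateLoop b u v rowCount h).exec t₂).2 := rfl
        rw [hx]
        nlinarith)
  refine ⟨h1, h2, h3, h5.trans ?_⟩
  have : (s.reg 0 + 1) * (g.size + u.size + v.size + h.size + 22) + 1 ≤
      (s.reg 0 + 1) * (g.size + u.size + v.size + h.size + 23) := by nlinarith
  gcongr

/-- Compute the Householder vector and scalar for the column in register 3 of array 0. -/
def reflectorProgram (a : ℕ) : Program :=
  .seq (sumLoop (.sub rowCount (.var 3))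
      (.mul (.read 0 (.add (.var 3) (.var 5)) (.var 3))
        (.conj (.read 0 (.add (.var 3) (.var 5)) (.var 3)))))
  (.seq (.store 4 (.const 0) (.const 1) (.sqrt (.read 4 (.const 0) (.const 0))))
  (.seq (updateLoop a (.add (.var 3) (.var 5)) (.var 3) (.sub rowCount (.var 3))
      (.read 0 (.add (.var 3) (.var 5)) (.var 3)))
  (.seq (.store a (.var 3) (.var 3)
      (.sub (.read a (.var 3) (.var 3)) (.read 4 (.const 0) (.const 1))))
    (.store 2 (.var 3) (.const 0)
      (.div (.const 1)
        (.sub (.mul (.read 4 (.const 0) (.const 1)) (.read 4 (.const 0) (.const 1)))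
          (.mul (.read 4 (.const 0) (.const 1)) (.conj (.read 0 (.var 3) (.var 3))))))))))

theorem tailNorm_eq_sqrt_sum_range {n : ℕ} (f : ℕ → ℂ) (k : Fin n) :
    tailNorm (fun i : Fin n => f i) k =
      √(∑ i ∈ Finset.range (n - k), f (k + i) * star (f (k + i))).re := by
  have h : ∑ i : Fin n with k ≤ i, ‖f i‖ ^ 2 = ∑ i ∈ Finset.range (n - k), ‖f (k + i)‖ ^ 2 := by
    rw [← Finset.sum_Ico_eq_sum_range (fun i => ‖f i‖ ^ 2), Finset.sum_filter]
    simp only [Fin.le_def]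
    rw [Fin.sum_univ_eq_sum_range (fun i => if (k : ℕ) ≤ i then ‖f i‖ ^ 2 else 0),
      ← Finset.sum_filter]
    congr 1
    ext i
    simp [and_comm]
  rw [tailNorm, h, Complex.re_sum]
  congr 1
  refine Finset.sum_congr rfl fun i _ => ?_
  have : f (k + i) * star (f (k + i)) = (‖f (k + i)‖ : ℂ) ^ 2 := RCLike.mul_conj _
  rw [this]
  norm_cast

/-- Only entries from row k on are written, so column k of array a must start at zero to give the
leading zeros of the Householder vector. -/
theorem exec_reflectorProgram {a N k : ℕ} {s : Store} (ha0 : a ≠ 0) (ha2 : a ≠ 2) (ha4 : a ≠ 4)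
    (hN : s.reg 0 = N) (hk : s.reg 3 = k) (hkN : k < N + 1) (hz : ∀ i, s.mem a i k = 0) :
    (∀ y < 5, ((reflectorProgram a).exec s).1.reg y = s.reg y) ∧
    (∀ b, b ≠ a → b ≠ 2 → b ≠ 4 → ((reflectorProgram a).exec s).1.mem b = s.mem b) ∧
    (∀ i : Fin (N + 1), ((reflectorProgram a).exec s).1.mem a i k =
      householderVector (fun i : Fin (N + 1) => s.mem 0 i k) ⟨k, hkN⟩ i) ∧
    (∀ i l, l ≠ k → ((reflectorProgram a).exec s).1.mem a i l = s.mem a i l) ∧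
    ((reflectorProgram a).exec s).1.mem 2 k 0 =
      householderScalar (fun i : Fin (N + 1) => s.mem 0 i k) ⟨k, hkN⟩ ∧
    (∀ l, l ≠ k → ((reflectorProgram a).exec s).1.mem 2 l 0 = s.mem 2 l 0) ∧
    ((reflectorProgram a).exec s).2 ≤ (N + 1) * 100 := by
  set n := N + 1 - k with hn
  set β : ℝ := tailNorm (fun i : Fin (N + 1) => s.mem 0 i k) ⟨k, hkN⟩ with hβ
  obtain ⟨a1, a2, a3, a4⟩ := exec_sumLoop (s := s) (e := .sub rowCount (.var 3))
    (g := .mul (.read 0 (.add (.var 3) (.var 5)) (.var 3))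
        (.conj (.read 0 (.add (.var 3) (.var 5)) (.var 3))))
    (fun i => s.mem 0 (k + i) k * star (s.mem 0 (k + i) k)) (by
      intro t ht hm
      have h3 : t.reg 3 = k := (ht 3 (by norm_num)).trans hk
      simp only [ScalarExpr.eval, IndexExpr.eval, h3, hm 0 (by norm_num)])
  have hev : IndexExpr.eval s (.sub rowCount (.var 3)) = n := by
    simp only [IndexExpr.eval, rowCount_eval, hN, hk, hn]
  rw [hev] at a3 a4
  set s₁ := ((sumLoop (.sub rowCount (.var 3))
    (.mul (.read 0 (.add (.var 3) (.var 5)) (.var 3))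
        (.conj (.read 0 (.add (.var 3) (.var 5)) (.var 3))))).exec s).1 with hs₁
  set s₂ := s₁.setMem 4 0 1 (β : ℂ) with hs₂
  have hx₂ : ((Program.store 4 (.const 0) (.const 1)
      (.sqrt (.read 4 (.const 0) (.const 0)))).exec s₁).1 = s₂ := by
    simp only [Program.exec, ScalarExpr.eval, IndexExpr.eval, a3, hs₂, hβ]
    rw [tailNorm_eq_sqrt_sum_range (fun i => s.mem 0 i k)]
  have hm₂ : ∀ b, b ≠ 4 → s₂.mem b = s.mem b := fun b hb => by
    rw [← a2 b hb]
    ext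
    simp [hs₂, Store.setMem, hb]
  obtain ⟨b1, b2, b3, b4, b5⟩ := exec_updateLoop (s := s₂) (a := a)
    (u := .add (.var 3) (.var 5)) (v := .var 3) (e := .sub rowCount (.var 3))
    (g := .read 0 (.add (.var 3) (.var 5)) (.var 3)) (fun i => k + i) (fun _ => k)
    (fun i => s.mem 0 (k + i) k)
    (fun t ht => by
      simp only [IndexExpr.eval, ht 3 (by norm_num)]
      rw [← hk, ← a1 3 (by norm_num)]; rfl)
    (fun t ht => by
      simp only [IndexExpr.eval, ht 3 (by norm_num)]
      rw [← hk, ← a1 3 (by norm_num)]; rfl)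
    (fun i j h _ => Nat.add_left_cancel h)
    (fun t ht hm _ => by
      have h3 : t.reg 3 = k := (ht 3 (by norm_num)).trans ((a1 3 (by norm_num)).trans hk)
      simp only [ScalarExpr.eval, IndexExpr.eval, h3, hm 0 ha0.symm, hm₂ 0 (by norm_num)])
  have hev₂ : IndexExpr.eval s₂ (.sub rowCount (.var 3)) = n := by
    rw [← hev, hs₂, IndexExpr.eval_setMem]
    simp only [IndexExpr.eval, rowCount_eval, a1 0 (by norm_num), a1 3 (by norm_num)]
  rw [hev₂] at b3 b4 b5
  set s₃ := ((updateLoop a (.add (.var 3) (.var 5)) (.var 3) (.sub rowCount (.var 3))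
      (.read 0 (.add (.var 3) (.var 5)) (.var 3))).exec s₂).1 with hs₃
  have hr₃ : ∀ y < 5, s₃.reg y = s.reg y := fun y hy => (b1 y hy).trans (a1 y hy)
  have hk₃ : s₃.reg 3 = k := (hr₃ 3 (by norm_num)).trans hk
  have hβ₃ : s₃.mem 4 0 1 = β := by
    rw [b2 4 ha4.symm]
    simp [hs₂, Store.setMem]
  have hm0₃ : s₃.mem 0 = s.mem 0 := (b2 0 ha0.symm).trans (hm₂ 0 (by norm_num))
  have hkk₃ : s₃.mem a k k = s.mem 0 k k := by
    simpa using b3 0 (by omega)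
  set s₄ := s₃.setMem a k k (s.mem 0 k k - β) with hs₄
  have hx₄ : ((Program.store a (.var 3) (.var 3)
      (.sub (.read a (.var 3) (.var 3)) (.read 4 (.const 0) (.const 1)))).exec s₃).1 = s₄ := by
    simp only [Program.exec, ScalarExpr.eval, IndexExpr.eval, hk₃, hkk₃, hβ₃, hs₄]
  set τ := householderScalar (fun i : Fin (N + 1) => s.mem 0 i k) ⟨k, hkN⟩ with hτ
  have hx₅ : ((Program.store 2 (.var 3) (.const 0)
      (.div (.const 1)
        (.sub (.mul (.read 4 (.const 0) (.const 1)) (.read 4 (.const 0) (.const 1)))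
          (.mul (.read 4 (.const 0) (.const 1)) (.conj (.read 0 (.var 3) (.var 3))))))).exec s₄).1 =
      s₄.setMem 2 k 0 τ := by
    have h40 : s₄.mem 4 0 1 = β := by
      rw [← hβ₃]
      simp [hs₄, Store.setMem, ha4.symm]
    have h00 : s₄.mem 0 k k = s.mem 0 k k := by
      rw [← hm0₃]
      simp [hs₄, Store.setMem, ha0.symm]
    have h3 : s₄.reg 3 = k := hk₃
    simp only [Program.exec, ScalarExpr.eval, IndexExpr.eval, h3, h40, h00, hτ, householderScalar,
      ← hβ, Nat.cast_one]
  have hfinal : ((reflectorProgram a).exec s).1 = s₄.setMem 2 k 0 τ := by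
    rw [← hx₅, ← hx₄, hs₃, ← hx₂]
    rfl
  have hma : ∀ i l, (s₄.setMem 2 k 0 τ).mem a i l = s₄.mem a i l := fun i l => by
    simp [Store.setMem, ha2]
  rw [hfinal]
  refine ⟨hr₃, fun b hba hb2 hb4 => ?_, fun i => ?_, fun i l hl => ?_, ?_, fun l hl => ?_, ?_⟩
  · rw [← hm₂ b hb4, ← b2 b hba]
    ext
    simp [hs₄, Store.setMem, hba, hb2]
  · rw [hma, householderVector]
    simp only [← hβ]
    rcases lt_trichotomy (i : ℕ) k with hi | hi | hi
    · have hlt : i < ⟨k, hkN⟩ := hi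
      rw [if_pos hlt]
      have h1 := b4 i k fun j _ hc => by omega
      rw [hm₂ a ha4, hz] at h1
      rw [← h1]
      simp [hs₄, Store.setMem, hi.ne]
    · have heq : i = ⟨k, hkN⟩ := Fin.ext hi
      rw [if_neg (by rw [heq]; exact lt_irrefl _), if_pos heq, hi]
      simp [hs₄, Store.setMem]
    · have hgt : ⟨k, hkN⟩ < i := hi
      rw [if_neg hgt.not_gt, if_neg hgt.ne']
      have h1 := b3 (i - k) (by omega)
      rw [show k + (i - k) = (i : ℕ) by omega] at h1
      rw [← h1]
      simp [hs₄, Store.setMem, hi.ne']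
  · rw [hma, ← hm₂ a ha4, ← b4 i l fun j _ hc => hl hc.2]
    simp [hs₄, Store.setMem, hl]
  · simp [Store.setMem]
  · rw [← hm₂ 2 (by norm_num), ← b2 2 ha2.symm]
    simp [hs₄, Store.setMem, ha2.symm, hl]
  · have hx : ((reflectorProgram a).exec s).2 = ((sumLoop (.sub rowCount (.var 3))
        (.mul (.read 0 (.add (.var 3) (.var 5)) (.var 3))
        (.conj (.read 0 (.add (.var 3) (.var 5)) (.var 3))))).exec s).2 +
        (((Program.store 4 (.const 0) (.const 1)
          (.sqrt (.read 4 (.const 0) (.const 0)))).exec s₁).2 +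
        (((updateLoop a (.add (.var 3) (.var 5)) (.var 3) (.sub rowCount (.var 3))
        (.read 0 (.add (.var 3) (.var 5)) (.var 3))).exec s₂).2 + (10 + 21))) := by
      rw [← hx₂]
      rfl
    rw [hx]
    simp only [Program.exec, ScalarExpr.size, IndexExpr.size, rowCount] at a4 b5 ⊢
    omega

/-! ### Products of reflectors -/

/-- The product of the first `m` reflectors, with vectors in array `a` and scalars in array 2. -/
def Store.reflectorProduct (s : Store) (a n m : ℕ) : Matrix (Fin n) (Fin n) ℂ :=
  ((List.range m).map fun k => reflector (s.mem 2 k 0) fun i : Fin n => s.mem a i k).prod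

theorem Store.outputReflectors_eq (s : Store) (n m : ℕ) :
    s.outputReflectors n m = s.reflectorProduct 1 n m := rfl

theorem Store.reflectorProduct_succ (s : Store) (a n m : ℕ) :
    s.reflectorProduct a n (m + 1) =
      s.reflectorProduct a n m * reflector (s.mem 2 m 0) fun i : Fin n => s.mem a i m := by
  simp [Store.reflectorProduct, List.range_succ]

theorem Store.reflectorProduct_congr {s t : Store} {a b n m : ℕ}
    (h2 : ∀ k < m, s.mem 2 k 0 = t.mem 2 k 0)
    (ha : ∀ i < n, ∀ k < m, s.mem a i k = t.mem b i k) :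
    s.reflectorProduct a n m = t.reflectorProduct b n m := by
  unfold Store.reflectorProduct
  congr 1
  refine List.map_congr_left fun k hk => ?_
  rw [List.mem_range] at hk
  simp only [h2 k hk, ha _ (Fin.is_lt _) k hk]

/-- The program builds min(N,M)+1 reflectors while the output format reads M+1; the surplus ones
have scalar zero and are identities. -/
theorem Store.reflectorProduct_of_le {s : Store} {a n m m' : ℕ} (h : m ≤ m')
    (h2 : ∀ k, m ≤ k → s.mem 2 k 0 = 0) :
    s.reflectorProduct a n m' = s.reflectorProduct a n m := by
  induction m', h using Nat.le_induction with
  | base => rfl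
  | succ k hk ih =>
    rw [Store.reflectorProduct_succ, ih, h2 k hk]
    simp [reflector]

/-! ### Householder factorization -/

/-- Multiply the columns of array 0 by the adjoint of the reflector in register 3. -/
def applyReflector (a : ℕ) : Program :=
  rankOneLoop 0 (.var 5) (.var 4) (.var 2)
    (.mul (.conj (.read a (.var 5) (.var 3))) (.read 0 (.var 5) (.var 4)))
    (.sub (.read 0 (.var 5) (.var 4))
      (.mul (.mul (.conj (.read 2 (.var 3) (.const 0))) (.read 4 (.const 0) (.const 0)))
        (.read a (.var 5) (.var 3))))

theorem exec_applyReflector {a N k : ℕ} {s : Store} (ha0 : a ≠ 0) (ha4 : a ≠ 4)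
    (hN : s.reg 0 = N) (hk : s.reg 3 = k) :
    (∀ y < 4, ((applyReflector a).exec s).1.reg y = s.reg y) ∧
    (∀ c, c ≠ 0 → c ≠ 4 → ((applyReflector a).exec s).1.mem c = s.mem c) ∧
    (∀ i : Fin (N + 1), ∀ j < s.reg 2, ((applyReflector a).exec s).1.mem 0 i j =
      (star (reflector (s.mem 2 k 0) fun i : Fin (N + 1) => s.mem a i k)).mulVec
        (fun i : Fin (N + 1) => s.mem 0 i j) i) ∧
    ((applyReflector a).exec s).2 ≤ s.reg 2 * ((N + 1) * 49) + 2 := by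
  obtain ⟨h1, h2, h3, h4⟩ := exec_rankOneLoop (b := 0) (u := .var 5) (v := .var 4) (e := .var 2)
    (g := .mul (.conj (.read a (.var 5) (.var 3))) (.read 0 (.var 5) (.var 4)))
    (h := .sub (.read 0 (.var 5) (.var 4))
      (.mul (.mul (.conj (.read 2 (.var 3) (.const 0))) (.read 4 (.const 0) (.const 0)))
        (.read a (.var 5) (.var 3)))) (s := s) (by norm_num) (fun i _ => i) (fun _ j => j)
    (fun i j => star (s.mem a i k) * s.mem 0 i j)
    (fun i j z => s.mem 0 i j - star (s.mem 2 k 0) * z * s.mem a i k)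
    (fun _ _ => rfl) (fun _ _ => rfl) (fun _ _ _ _ hi hj => ⟨hi, hj⟩)
    (fun t ht hm hb => by
      have h3 : t.reg 3 = k := (ht 3 (by norm_num)).trans hk
      simp only [ScalarExpr.eval, IndexExpr.eval, h3, hm a ha0 ha4, hb])
    (fun t ht hm hb => by
      have h3 : t.reg 3 = k := (ht 3 (by norm_num)).trans hk
      simp only [ScalarExpr.eval, IndexExpr.eval, h3, hm a ha0 ha4,
        hm 2 (by norm_num) (by norm_num), hb])
  rw [hN] at h3 h4
  refine ⟨h1, h2, fun i j hj => ?_, h4⟩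
  rw [star_reflector, reflector_mulVec]
  refine (h3 i i.2 j hj).trans ?_
  rw [← Fin.sum_univ_eq_sum_range fun l => star (s.mem a l k) * s.mem 0 l j]
  rfl

/-- Householder factorization of the first `min N M + 1` columns of array 0: the vectors of the
reflectors go to array `a`, their scalars to array 2. -/
def factorProgram (a : ℕ) : Program :=
  -- By truncated subtraction, N+1-(N-M) equals min(N,M)+1.
  .seq (.assign 2 (.sub rowCount (.sub (.var 0) (.var 1))))
    (.loop 3 (.var 2) (.seq (reflectorProgram a) (applyReflector a)))

/-- The state after `k` steps of the factorization of the `n × m` matrix `A`. -/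
structure FactorInvariant (a : ℕ) {n m : ℕ} (A : Matrix (Fin n) (Fin m) ℂ) (s : Store) (k : ℕ)
    (t : Store) : Prop where
  reg : ∀ y < 3, t.reg y = s.reg y
  mem : ∀ b, b ≠ 0 → b ≠ a → b ≠ 2 → b ≠ 4 → t.mem b = s.mem b
  unitary : t.reflectorProduct a n k ∈ Matrix.unitaryGroup (Fin n) ℂ
  product : t.reflectorProduct a n k * Matrix.of (fun (i : Fin n) (j : Fin m) => t.mem 0 i j) = A
  triangular : ∀ (i : Fin n) (j : Fin m), (j : ℕ) < k → (j : ℕ) < i → t.mem 0 i j = 0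
  diag : ∀ (i : Fin n) (j : Fin m), (j : ℕ) < k → (i : ℕ) = j →
    0 ≤ (t.mem 0 i j).re ∧ (t.mem 0 i j).im = 0
  -- Cells not yet written are zero: unused factors are then trivial, and the next Householder
  -- vector gets its leading zeros.
  scalar : ∀ l, k ≤ l → t.mem 2 l 0 = 0
  vector : ∀ i l, k ≤ l → t.mem a i l = 0

/-- Q becomes QH and the array becomes H†A, so their product is preserved. H† leaves the earlier
columns alone and brings column k to triangular form. -/
theorem FactorInvariant.step {a N K k : ℕ} {A : Matrix (Fin (N + 1)) (Fin K) ℂ} {s t : Store}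
    (ha0 : a ≠ 0) (ha2 : a ≠ 2) (ha4 : a ≠ 4) (hN : s.reg 0 = N) (hK : s.reg 2 = K)
    (hKN : K ≤ N + 1) (hk : k < K) (h : FactorInvariant a A s k t) :
    FactorInvariant a A s (k + 1)
      ((Program.seq (reflectorProgram a) (applyReflector a)).exec (t.setReg 3 k)).1 ∧
    ((Program.seq (reflectorProgram a) (applyReflector a)).exec (t.setReg 3 k)).2 ≤
      (N + 1) * 100 + (K * ((N + 1) * 49) + 2) := by
  set t₁ := t.setReg 3 k with ht₁
  have hr₁ : ∀ y < 3, t₁.reg y = s.reg y := fun y hy => by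
    simp [ht₁, Store.setReg, hy.ne, h.reg y hy]
  have hk₁ : t₁.reg 3 = k := by simp [ht₁, Store.setReg]
  obtain ⟨a1, a2, a3, a4, a5, a6, a7⟩ := exec_reflectorProgram (a := a) (s := t₁) ha0 ha2 ha4
    ((hr₁ 0 (by norm_num)).trans hN) hk₁ (by omega) (fun i => h.vector i k le_rfl)
  set t₂ := ((reflectorProgram a).exec t₁).1 with ht₂
  have hr₂ : ∀ y < 3, t₂.reg y = s.reg y := fun y hy => (a1 y (by omega)).trans (hr₁ y hy)
  obtain ⟨b1, b2, b3, b4⟩ := exec_applyReflector (a := a) (s := t₂) (N := N) (k := k) ha0 ha4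
    ((hr₂ 0 (by norm_num)).trans hN) ((a1 3 (by norm_num)).trans hk₁)
  rw [(hr₂ 2 (by norm_num)).trans hK] at b3 b4
  have hx : (Program.seq (reflectorProgram a) (applyReflector a)).exec t₁ =
    (((applyReflector a).exec t₂).1,
      ((reflectorProgram a).exec t₁).2 + ((applyReflector a).exec t₂).2) := rfl
  rw [hx]
  set t₃ := ((applyReflector a).exec t₂).1 with ht₃
  set κ : Fin (N + 1) := ⟨k, by omega⟩ with hκ
  set x : Fin (N + 1) → ℂ := fun i => t.mem 0 i k with hx'
  have hw : (fun i : Fin (N + 1) => t₃.mem a i k) = householderVector x κ := by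
    ext i
    rw [b2 a ha0 ha4]
    exact a3 i
  have hτ : t₃.mem 2 k 0 = householderScalar x κ := by
    rw [b2 2 (by norm_num) (by norm_num)]
    exact a5
  have hcol : ∀ (i : Fin (N + 1)) (j : Fin K), t₃.mem 0 i j =
      (star (reflector (householderScalar x κ) (householderVector x κ))).mulVec
        (fun i : Fin (N + 1) => t.mem 0 i j) i := fun i j => by
    rw [b3 i j j.2, ← hτ, ← hw, a2 0 ha0.symm (by norm_num) (by norm_num),
      b2 2 (by norm_num) (by norm_num), b2 a ha0 ha4]
    rfl
  have hU := householder_mem_unitaryGroup x κ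
  have hprod : t₃.reflectorProduct a (N + 1) k = t.reflectorProduct a (N + 1) k :=
    Store.reflectorProduct_congr
      (fun l hl => by
        rw [b2 2 (by norm_num) (by norm_num)]
        exact a6 l hl.ne)
      (fun i _ l hl => by
        rw [b2 a ha0 ha4]
        exact a4 i l hl.ne)
  have hmat : (Matrix.of fun (i : Fin (N + 1)) (j : Fin K) => t₃.mem 0 i j) =
      star (reflector (householderScalar x κ) (householderVector x κ)) *
        Matrix.of fun (i : Fin (N + 1)) (j : Fin K) => t.mem 0 i j := by
    ext i j
    exact hcol i j
  have hold : ∀ (i : Fin (N + 1)) (j : Fin K), (j : ℕ) < k → t₃.mem 0 i j = t.mem 0 i j :=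
    fun i j hj => by
      rw [hcol, star_householder_mulVec_of_eq_zero]
      intro l hl
      exact h.triangular l j hj (hj.trans_le hl)
  have hnew : ∀ (i : Fin (N + 1)) (j : Fin K), (j : ℕ) = k → t₃.mem 0 i j =
      if i < κ then x i else if i = κ then (tailNorm x κ : ℂ) else 0 := fun i j hj => by
    rw [hcol, hj]
    exact star_householder_mulVec_self x κ i
  refine ⟨⟨fun y hy => (b1 y (by omega)).trans (hr₂ y hy), fun b hb0 hba hb2 hb4 => ?_, ?_, ?_,
    fun i j hj hji => ?_, fun i j hj hij => ?_, fun l hl => ?_, fun i l hl => ?_⟩,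
    Nat.add_le_add a7 b4⟩
  · rw [b2 b hb0 hb4, a2 b hba hb2 hb4]
    exact h.mem b hb0 hba hb2 hb4
  · rw [Store.reflectorProduct_succ, hprod, hw, hτ]
    exact mul_mem h.unitary hU
  · rw [Store.reflectorProduct_succ, hprod, hw, hτ, hmat, Matrix.mul_assoc,
      ← Matrix.mul_assoc (reflector _ _), Matrix.mem_unitaryGroup_iff.1 hU, Matrix.one_mul]
    exact h.product
  · rcases Nat.lt_succ_iff_lt_or_eq.1 hj with hj | hj
    · rw [hold i j hj]
      exact h.triangular i j hj hji
    · have hlt : κ < i := Fin.lt_def.2 (by simpa [hκ, ← hj] using hji)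
      rw [hnew i j hj, if_neg hlt.not_gt, if_neg hlt.ne']
  · rcases Nat.lt_succ_iff_lt_or_eq.1 hj with hj | hj
    · rw [hold i j hj]
      exact h.diag i j hj hij
    · have heq : i = κ := Fin.ext (hij.trans hj)
      rw [hnew i j hj, heq, if_neg (lt_irrefl _), if_pos rfl]
      exact ⟨by rw [Complex.ofReal_re]; exact Real.sqrt_nonneg _, Complex.ofReal_im _⟩
  · rw [b2 2 (by norm_num) (by norm_num), a6 l (by omega)]
    exact h.scalar l (by omega)
  · rw [b2 a ha0 ha4, a4 i l (by omega)]
    exact h.vector i l (by omega)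

/-- Correctness and cost of the factorization program. -/
theorem exec_factorProgram {a N M : ℕ} (A : Matrix (Fin (N + 1)) (Fin (M + 1)) ℂ)
    (ha0 : a ≠ 0) (ha2 : a ≠ 2) (ha4 : a ≠ 4) :
    (∀ b, b ≠ 0 → b ≠ a → b ≠ 2 → b ≠ 4 →
      ((factorProgram a).exec (inputStore A)).1.mem b = fun _ _ => 0) ∧
    ((factorProgram a).exec (inputStore A)).1.reg 0 = N ∧
    ((factorProgram a).exec (inputStore A)).1.reg 2 = min N M + 1 ∧
    IsQRFactor (((factorProgram a).exec (inputStore A)).1.reflectorProduct a (N + 1) (min N M + 1))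
      A ∧
    (∀ l, min N M + 1 ≤ l → ((factorProgram a).exec (inputStore A)).1.mem 2 l 0 = 0) ∧
    ((factorProgram a).exec (inputStore A)).2 ≤ 200 * ((N + 1) * (min N M + 1) ^ 2) := by
  set K := min N M + 1 with hK
  have hKN : K ≤ N + 1 := by omega
  have hKM : K ≤ M + 1 := by omega
  set s₁ := (inputStore A).setReg 2 K with hs₁
  have hx : (factorProgram a).exec (inputStore A) =
      (((Program.loop 3 (.var 2) (.seq (reflectorProgram a) (applyReflector a))).exec s₁).1,
        8 + ((Program.loop 3 (.var 2)
          (.seq (reflectorProgram a) (applyReflector a))).exec s₁).2) := by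
    have hev : IndexExpr.eval (inputStore A) (.sub rowCount (.sub (.var 0) (.var 1))) = K := by
      simp only [IndexExpr.eval, rowCount_eval, inputStore]
      simp only [if_true, one_ne_zero, if_false]
      omega
    simp only [factorProgram, Program.exec.eq_3, Program.exec.eq_1, hev, ← hs₁]
    rfl
  have hK₁ : IndexExpr.eval s₁ (.var 2) = K := by simp [IndexExpr.eval, hs₁, Store.setReg]
  obtain ⟨h1, h2⟩ := exec_loop_spec (x := 3) (e := .var 2)
    (p := .seq (reflectorProgram a) (applyReflector a)) (s := s₁)
    (c := (N + 1) * 100 + (K * ((N + 1) * 49) + 2))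
    (FactorInvariant a (Matrix.of fun (i : Fin (N + 1)) (j : Fin K) => A i (j.castLE hKM)) s₁)
    (by
      refine ⟨fun _ _ => rfl, fun _ _ _ _ _ => rfl, ?_, ?_, fun i j hj => absurd hj (by omega),
        fun i j hj => absurd hj (by omega), fun l _ => ?_, fun i l _ => ?_⟩
      · simp [Store.reflectorProduct, one_mem]
      · simp only [Store.reflectorProduct, List.range_zero, List.map_nil, List.prod_nil,
          Matrix.one_mul]
        ext i j
        have hj : (j : ℕ) < M + 1 := by omega
        have hi : (i : ℕ) < N + 1 := i.2
        simp only [hs₁, Store.setReg, inputStore, Matrix.of_apply]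
        rw [dif_pos ⟨trivial, hi, hj⟩]
        rfl
      · simp [hs₁, Store.setReg, inputStore]
      · simp [hs₁, Store.setReg, inputStore, ha0])
    (by
      intro k hk t ht
      rw [hK₁] at hk
      exact ht.step ha0 ha2 ha4 (by simp [hs₁, Store.setReg, inputStore]) hK₁ hKN hk)
  rw [hK₁] at h1 h2
  rw [hx]
  set t := ((Program.loop 3 (.var 2) (.seq (reflectorProgram a) (applyReflector a))).exec s₁).1
  refine ⟨fun b hb0 hba hb2 hb4 => ?_, ?_, ?_, ⟨h1.unitary, ?_⟩, h1.scalar, ?_⟩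
  · refine (h1.mem b hb0 hba hb2 hb4).trans ?_
    ext
    simp [hs₁, Store.setReg, inputStore, hb0]
  · exact (h1.reg 0 (by norm_num)).trans (by simp [hs₁, Store.setReg, inputStore])
  · exact (h1.reg 2 (by norm_num)).trans (by simp [hs₁, Store.setReg])
  · set Q := t.reflectorProduct a (N + 1) K with hQ
    have hcol : ∀ (i : Fin (N + 1)) (j : Fin (M + 1)), (j : ℕ) < K →
        (star Q * A) i j = t.mem 0 i j := fun i j hj => by
      have h3 : star Q * (Matrix.of fun (i : Fin (N + 1)) (j : Fin K) => A i (j.castLE hKM)) =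
          Matrix.of fun (i : Fin (N + 1)) (j : Fin K) => t.mem 0 i j := by
        rw [← h1.product, ← Matrix.mul_assoc, Matrix.mem_unitaryGroup_iff'.1 h1.unitary,
          Matrix.one_mul]
      exact congrFun (congrFun h3 i) ⟨j, hj⟩
    -- Columns beyond the first K are never transformed, so R is defined as Q†A. Such columns exist
    -- only if M > N; they then lie strictly to the right of the diagonal and carry no condition.
    refine ⟨star Q * A, ?_, fun i j hji => ?_, fun i j hij => ?_⟩
    · rw [← Matrix.mul_assoc, Matrix.mem_unitaryGroup_iff.1 h1.unitary, Matrix.one_mul]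
    · have hj : (j : ℕ) < K := by omega
      rw [hcol i j hj]
      exact h1.triangular i ⟨j, hj⟩ hj hji
    · have hj : (j : ℕ) < K := by omega
      rw [hcol i j hj]
      exact h1.diag i ⟨j, hj⟩ hj hij
  · have hs : (IndexExpr.var 2).size = 1 := rfl
    rw [hs] at h2
    dsimp only
    have hK1 : 1 ≤ K := by omega
    have e1 : K * (N + 1) ≤ (N + 1) * K ^ 2 := by nlinarith [Nat.mul_le_mul_left (K * (N + 1)) hK1]
    have e2 : 1 ≤ K * (N + 1) := Nat.mul_pos hK1 (Nat.succ_pos N)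
    have e3 : K ≤ K * (N + 1) := Nat.le_mul_of_pos_right K (Nat.succ_pos N)
    have e4 : K * ((N + 1) * 100 + (K * ((N + 1) * 49) + 2) + 1) =
      100 * (K * (N + 1)) + 49 * ((N + 1) * K ^ 2) + 3 * K := by ring
    rw [e4] at h2
    omega

/-! ### Output of the reflectors -/

/-- Copy the vectors of the reflectors from array 3 to array 1. -/
def copyProgram : Program :=
  .loop 3 (.var 2) (updateLoop 1 (.var 5) (.var 3) rowCount (.read 3 (.var 5) (.var 3)))

theorem exec_copyProgram {N K : ℕ} {s : Store} (hN : s.reg 0 = N) (hK : s.reg 2 = K) :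
    (copyProgram.exec s).1.mem 2 = s.mem 2 ∧
    (∀ i < N + 1, ∀ k < K, (copyProgram.exec s).1.mem 1 i k = s.mem 3 i k) ∧
    (copyProgram.exec s).2 ≤ K * ((N + 1) * 7 + 5) + 2 := by
  have hK' : IndexExpr.eval s (.var 2) = K := hK
  obtain ⟨⟨-, h2, h3⟩, h4⟩ := exec_loop_spec (x := 3) (e := .var 2)
    (p := updateLoop 1 (.var 5) (.var 3) rowCount (.read 3 (.var 5) (.var 3)))
    (s := s) (c := (N + 1) * 7 + 4)
    (fun k t => t.reg 0 = N ∧ (∀ c, c ≠ 1 → t.mem c = s.mem c) ∧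
      ∀ i < N + 1, ∀ l < k, t.mem 1 i l = s.mem 3 i l)
    ⟨hN, fun _ _ => rfl, fun i _ l hl => absurd hl (Nat.not_lt_zero l)⟩
    (by
      rintro k - t ⟨h1, h2, h3⟩
      have hk : (t.setReg 3 k).reg 3 = k := by simp [Store.setReg]
      have h0 : (t.setReg 3 k).reg 0 = N := by simp [Store.setReg, h1]
      obtain ⟨c1, c2, c3, c4, c5⟩ := exec_updateLoop (a := 1) (u := .var 5) (v := .var 3)
        (e := rowCount) (g := .read 3 (.var 5) (.var 3)) (s := t.setReg 3 k)
        (fun i => i) (fun _ => k) (fun i => s.mem 3 i k) (fun _ _ => rfl)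
        (fun t' ht' => (ht' 3 (by norm_num)).trans hk) (fun _ _ h _ => h)
        (fun t' ht' hm' _ => by
          simp only [ScalarExpr.eval, IndexExpr.eval, (ht' 3 (by norm_num)).trans hk,
            (hm' 3 (by norm_num)).trans (h2 3 (by norm_num))])
      rw [rowCount_eval, h0] at c3 c4 c5
      refine ⟨⟨(c1 0 (by norm_num)).trans h0, fun c hc => (c2 c hc).trans (h2 c hc),
        fun i hi l hl => ?_⟩, c5⟩
      rcases Nat.lt_succ_iff_lt_or_eq.1 hl with hl | rfl
      · rw [c4 i l fun j _ hc => hl.ne hc.2]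
        exact h3 i hi l hl
      · exact c3 i hi)
  rw [hK'] at h3 h4
  exact ⟨h2 2 (by norm_num), h3, h4⟩

/-! ### Accumulating the entries of the unitary factor -/

/-- Multiply the matrix in array 1 from the right by the reflector in register 3. -/
def multiplyReflector : Program :=
  rankOneLoop 1 (.var 4) (.var 5) rowCount
    (.mul (.read 1 (.var 4) (.var 5)) (.read 3 (.var 5) (.var 3)))
    (.sub (.read 1 (.var 4) (.var 5))
      (.mul (.mul (.read 2 (.var 3) (.const 0)) (.read 4 (.const 0) (.const 0)))
        (.conj (.read 3 (.var 5) (.var 3)))))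

theorem mul_reflector_apply {n : ℕ} (B : Matrix (Fin n) (Fin n) ℂ) (τ : ℂ) (w : Fin n → ℂ)
    (i j : Fin n) :
    (B * reflector τ w) i j = B i j - τ * (∑ l, B i l * w l) * star (w j) := by
  rw [reflector, Matrix.mul_sub, Matrix.mul_one, Matrix.mul_smul, Matrix.mul_vecMulVec,
    Matrix.sub_apply, Matrix.smul_apply, Matrix.vecMulVec_apply, smul_eq_mul, mul_assoc]
  rfl

/-- Here register 4 runs over rows and register 5 over columns, the reverse of `applyReflector`,
because the reflector acts from the right. -/
theorem exec_multiplyReflector {N k : ℕ} {s : Store} (hN : s.reg 0 = N) (hk : s.reg 3 = k) :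
    (∀ y < 4, (multiplyReflector.exec s).1.reg y = s.reg y) ∧
    (∀ c, c ≠ 1 → c ≠ 4 → (multiplyReflector.exec s).1.mem c = s.mem c) ∧
    (multiplyReflector.exec s).1.outputMatrix (N + 1) = s.outputMatrix (N + 1) *
      reflector (s.mem 2 k 0) (fun i : Fin (N + 1) => s.mem 3 i k) ∧
    (multiplyReflector.exec s).2 ≤ (N + 1) * ((N + 1) * 48) + 4 := by
  obtain ⟨h1, h2, h3, h4⟩ := exec_rankOneLoop (b := 1) (u := .var 4) (v := .var 5) (e := rowCount)
    (g := .mul (.read 1 (.var 4) (.var 5)) (.read 3 (.var 5) (.var 3)))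
    (h := .sub (.read 1 (.var 4) (.var 5))
      (.mul (.mul (.read 2 (.var 3) (.const 0)) (.read 4 (.const 0) (.const 0)))
        (.conj (.read 3 (.var 5) (.var 3))))) (s := s) (by norm_num) (fun _ j => j) (fun i _ => i)
    (fun i j => s.mem 1 j i * s.mem 3 i k)
    (fun i j z => s.mem 1 j i - s.mem 2 k 0 * z * star (s.mem 3 i k))
    (fun _ _ => rfl) (fun _ _ => rfl) (fun _ _ _ _ hi hj => ⟨hj, hi⟩)
    (fun t ht hm hb => by
      have h3 : t.reg 3 = k := (ht 3 (by norm_num)).trans hk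
      simp only [ScalarExpr.eval, IndexExpr.eval, h3, hm 3 (by norm_num) (by norm_num), hb])
    (fun t ht hm hb => by
      have h3 : t.reg 3 = k := (ht 3 (by norm_num)).trans hk
      simp only [ScalarExpr.eval, IndexExpr.eval, h3, hm 3 (by norm_num) (by norm_num),
        hm 2 (by norm_num) (by norm_num), hb])
  rw [rowCount_eval, hN] at h3 h4
  refine ⟨h1, h2, ?_, h4⟩
  ext i j
  rw [mul_reflector_apply]
  refine (h3 j j.2 i i.2).trans ?_
  rw [← Fin.sum_univ_eq_sum_range fun l => s.mem 1 i l * s.mem 3 l k]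
  rfl

/-- Write the product of the reflectors in arrays 3 and 2 to array 1. -/
def accumulateProgram : Program :=
  .seq (updateLoop 1 (.var 5) (.var 5) rowCount (.const 1)) (.loop 3 (.var 2) multiplyReflector)

/-- The identity is initialised by writing its diagonal only, so array 1 must be zero beforehand;
this is why the vectors are kept in array 3. -/
theorem exec_accumulateProgram {N K : ℕ} {s : Store} (hN : s.reg 0 = N) (hK : s.reg 2 = K)
    (h0 : s.mem 1 = fun _ _ => 0) :
    (accumulateProgram.exec s).1.outputMatrix (N + 1) = s.reflectorProduct 3 (N + 1) K ∧
    (accumulateProgram.exec s).2 ≤ 60 * ((N + 1) ^ 2 * (K + 1)) := by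
  obtain ⟨a1, a2, a3, a4, a5⟩ := exec_updateLoop (a := 1) (u := .var 5) (v := .var 5)
    (e := rowCount) (g := .const 1) (s := s) (fun i => i) (fun i => i) (fun _ => 1)
    (fun _ _ => rfl) (fun _ _ => rfl) (fun _ _ h _ => h)
    (fun _ _ _ _ => by simp [ScalarExpr.eval])
  rw [rowCount_eval, hN] at a3 a4 a5
  set s₁ := ((updateLoop 1 (.var 5) (.var 5) rowCount (.const 1)).exec s).1 with hs₁
  have hone : s₁.outputMatrix (N + 1) = 1 := by
    ext i j
    rw [Store.outputMatrix, Matrix.of_apply, Matrix.one_apply]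
    split_ifs with h
    · rw [h]
      exact a3 j j.2
    · rw [a4 i j fun l _ hc => h (Fin.ext (hc.1.trans hc.2.symm)), h0]
  have hK₁ : IndexExpr.eval s₁ (.var 2) = K := (a1 2 (by norm_num)).trans hK
  obtain ⟨⟨b1, b2, b3⟩, b4⟩ := exec_loop_spec (x := 3) (e := .var 2) (p := multiplyReflector)
    (s := s₁) (c := (N + 1) * ((N + 1) * 48) + 4)
    (fun k t => (∀ y < 3, t.reg y = s.reg y) ∧ (∀ c, c ≠ 1 → c ≠ 4 → t.mem c = s.mem c) ∧
      t.outputMatrix (N + 1) = s.reflectorProduct 3 (N + 1) k)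
    ⟨fun y hy => a1 y (by omega), fun c hc _ => a2 c hc, by
      rw [hone]; simp [Store.reflectorProduct]⟩
    (by
      rintro k - t ⟨h1, h2, h3⟩
      have hr : ∀ y < 3, (t.setReg 3 k).reg y = s.reg y := fun y hy => by
        simp [Store.setReg, hy.ne, h1 y hy]
      obtain ⟨c1, c2, c3, c4⟩ := exec_multiplyReflector (N := N) (k := k) (s := t.setReg 3 k)
        ((hr 0 (by norm_num)).trans hN) (by simp [Store.setReg])
      refine ⟨⟨fun y hy => (c1 y (by omega)).trans (hr y hy),
        fun c hc hc' => (c2 c hc hc').trans (h2 c hc hc'), ?_⟩, c4⟩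
      rw [c3, Store.reflectorProduct_succ, ← h3, ← h2 2 (by norm_num) (by norm_num),
        ← h2 3 (by norm_num) (by norm_num)]
      rfl)
  rw [hK₁] at b3 b4
  have hx : accumulateProgram.exec s = (((Program.loop 3 (.var 2) multiplyReflector).exec s₁).1,
    ((updateLoop 1 (.var 5) (.var 5) rowCount (.const 1)).exec s).2 +
      ((Program.loop 3 (.var 2) multiplyReflector).exec s₁).2) := rfl
  rw [hx]
  refine ⟨b3, ?_⟩
  simp only [IndexExpr.size, ScalarExpr.size, rowCount] at a5 b4 ⊢
  have e1 : N + 1 ≤ (N + 1) ^ 2 := Nat.le_self_pow (by norm_num) _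
  have e2 : 1 ≤ (N + 1) ^ 2 := Nat.one_le_pow _ _ (Nat.succ_pos N)
  have e3 : K ≤ (N + 1) ^ 2 * K := Nat.le_mul_of_pos_left K e2
  have e4 : K * ((N + 1) * ((N + 1) * 48) + 4 + 1) = 48 * ((N + 1) ^ 2 * K) + 5 * K := by ring
  have e5 : (N + 1) ^ 2 * (K + 1) = (N + 1) ^ 2 * K + (N + 1) ^ 2 := by ring
  rw [e4] at b4
  rw [e5]
  omega

/-! ### The two programs -/

/-- Householder factorization with output in factored form. -/
def factoredProgram : Program := .seq (factorProgram 3) copyProgram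

/-- Householder factorization with output of all entries of the unitary factor. -/
def entriesProgram : Program := .seq (factorProgram 3) accumulateProgram

/-- The unitary factor is not unique in general, so both outputs must be matched with one Q; both
programs start with the same factorization. -/
theorem exists_isQRFactor_output {N M : ℕ} (A : Matrix (Fin (N + 1)) (Fin (M + 1)) ℂ) :
    ∃ Q, IsQRFactor Q A ∧
      (factoredProgram.output A).outputReflectors (N + 1) (M + 1) = Q ∧
      factoredProgram.time A ≤ 220 * ((N + 1) * (M + 1) ^ 2) ∧
      (entriesProgram.output A).outputMatrix (N + 1) = Q ∧
      entriesProgram.time A ≤ 320 * ((N + 1) ^ 2 * (M + 1)) := by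
  obtain ⟨h1, h2, h3, h4, h5, h6⟩ := exec_factorProgram (a := 3) A (by norm_num) (by norm_num)
    (by norm_num)
  set s := ((factorProgram 3).exec (inputStore A)).1 with hs
  set K := min N M + 1 with hK
  obtain ⟨a1, a2, a3⟩ := exec_copyProgram h2 h3
  obtain ⟨b1, b2⟩ := exec_accumulateProgram h2 h3
    (h1 1 (by norm_num) (by norm_num) (by norm_num) (by norm_num))
  have hKN : K ≤ N + 1 := by omega
  have hKM : K ≤ M + 1 := by omega
  have hK1 : 1 ≤ K := by omega
  have e0 : (N + 1) * K ≤ (N + 1) * K ^ 2 :=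
    Nat.mul_le_mul_left _ (Nat.le_self_pow (by norm_num) K)
  refine ⟨_, h4, ?_, ?_, b1, ?_⟩
  · have hx : factoredProgram.output A = (copyProgram.exec s).1 := rfl
    rw [hx, Store.outputReflectors_eq, Store.reflectorProduct_of_le hKM
      fun k hk => by rw [a1]; exact h5 k hk]
    exact Store.reflectorProduct_congr (fun k _ => by rw [a1]) a2
  · have hx : factoredProgram.time A =
      ((factorProgram 3).exec (inputStore A)).2 + (copyProgram.exec s).2 := rfl
    have e1 : K * ((N + 1) * 7 + 5) = 7 * ((N + 1) * K) + 5 * K := by ring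
    have e2 : K ≤ (N + 1) * K := Nat.le_mul_of_pos_left K (Nat.succ_pos N)
    calc factoredProgram.time A ≤ 220 * ((N + 1) * K ^ 2) := by
          rw [e1] at a3
          omega
      _ ≤ 220 * ((N + 1) * (M + 1) ^ 2) := by gcongr
  · have hx : entriesProgram.time A =
      ((factorProgram 3).exec (inputStore A)).2 + (accumulateProgram.exec s).2 := rfl
    -- Since K ≤ N+1, the factorization is no more expensive than the accumulation.
    have e1 : (N + 1) * K ^ 2 ≤ (N + 1) ^ 2 * K := by
      have : (N + 1) * K ^ 2 = (N + 1) * K * K := by ring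
      have : (N + 1) ^ 2 * K = (N + 1) * K * (N + 1) := by ring
      nlinarith [Nat.mul_le_mul_left ((N + 1) * K) hKN]
    have e2 : (N + 1) ^ 2 * (K + 1) ≤ 2 * ((N + 1) ^ 2 * K) := by
      nlinarith [Nat.mul_le_mul_left ((N + 1) ^ 2) hK1]
    calc entriesProgram.time A ≤ 320 * ((N + 1) ^ 2 * K) := by omega
      _ ≤ 320 * ((N + 1) ^ 2 * (M + 1)) := by gcongr

end Bosonic

/-! ### Choice of N and bookkeeping of constants -/

/-- Absorbs the +1 of N+1 into the bound for N when the running time is expressed through E³/ε⁸. -/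
theorem Bosonic.one_le_mul_div_pow_four {E ε e : ℝ} (hε : 0 < ε) (hεE : ε ^ 2 ≤ E) (hε' : ε ≤ 2)
    (he : 1 ≤ e) : 1 ≤ 4 * (E / ε ^ 4) * e := by
  have h4 : ε ^ 2 ≤ 4 := by nlinarith
  have h1 : 1 ≤ 4 * (E / ε ^ 4) := by
    rw [← mul_div_assoc, one_le_div (by positivity)]
    calc ε ^ 4 = ε ^ 2 * ε ^ 2 := by ring
      _ ≤ 4 * E := mul_le_mul h4 hεE (by positivity) (by norm_num)
  exact one_le_mul_of_one_le_of_one_le h1 he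

theorem theorem1 :
    ∃ (C : ℝ) (P P' : Program), 0 < C ∧
      ∀ U : FockSpace ≃ₗᵢ[ℂ] FockSpace, IsPhysical U →
      ∀ E ε : ℝ, 0 ≤ E → 0 < ε →
        maximalEnergy U (64 * E / ε ^ 2) < ⊤ ∧
        ∃ (N : ℕ) (VN : fockSubspace N ≃ₗᵢ[ℂ] fockSubspace N),
          -- the effective dimension
          (N : ℝ≥0∞) ≤
            ENNReal.ofReal (C * (max E (ε ^ 2) / ε ^ 4)) * maximalEnergy U (64 * E / ε ^ 2) ∧
          -- the approximation, for every completion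
          (∀ V' : (fockSubspace N)ᗮ ≃ₗᵢ[ℂ] (fockSubspace N)ᗮ,
            ecDiamondNorm E
              (ampliatedChannel (toOperator U) - ampliatedChannel (directSum VN V'))
              ≤ ENNReal.ofReal ε) ∧
          -- `VN` is the unitary QR factor of the truncated matrix
          IsQRFactor (fockMatrix VN) (truncation U N ⌊64 * E / ε ^ 2⌋₊) ∧
          -- `P` computes `VN` in factored form
          (P.output (truncation U N ⌊64 * E / ε ^ 2⌋₊)).outputReflectors (N + 1)
            (⌊64 * E / ε ^ 2⌋₊ + 1) = fockMatrix VN ∧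
          (P.time (truncation U N ⌊64 * E / ε ^ 2⌋₊) : ℝ) ≤
            C * ((N + 1) * (max E (ε ^ 2)) ^ 2 / ε ^ 4) ∧
          (ε ^ 2 ≤ E → ε ≤ 2 →
            (P.time (truncation U N ⌊64 * E / ε ^ 2⌋₊) : ℝ≥0∞) ≤
              ENNReal.ofReal (C * (E ^ 3 / ε ^ 8)) * maximalEnergy U (64 * E / ε ^ 2)) ∧
          -- `P'` computes all the entries of `VN`
          (P'.output (truncation U N ⌊64 * E / ε ^ 2⌋₊)).outputMatrix (N + 1) = fockMatrix VN ∧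
          (P'.time (truncation U N ⌊64 * E / ε ^ 2⌋₊) : ℝ) ≤
            C * ((N + 1) ^ 2 * (max E (ε ^ 2) / ε ^ 2)) := by
  -- The largest constant needed is 929500 · 2084 = 1937078000, where 929500 = 220 · 65² and 2084 =
  -- 32 · 65 + 4.
  refine ⟨2000000000, factoredProgram, entriesProgram, by norm_num, fun U hU E ε hE hε => ?_⟩
  have hfin := hU.maximalEnergy_lt_top (64 * E / ε ^ 2)
  refine ⟨hfin, ?_⟩
  set x := 64 * E / ε ^ 2 with hx
  set e := (maximalEnergy U x).toReal with he
  set m := max E (ε ^ 2) with hm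
  have hε2 : 0 < ε ^ 2 := by positivity
  have he0 : 0 ≤ e := ENNReal.toReal_nonneg
  have hme : maximalEnergy U x = ENNReal.ofReal e := (ENNReal.ofReal_toReal hfin.ne).symm
  have hm0 : 0 < m := lt_max_of_lt_right hε2
  have hx0 : 0 ≤ x := by positivity
  set M := ⌊x⌋₊ with hM
  -- Taking the maximum with ε² makes m/ε² ≥ 1, which absorbs the +1.
  have hM1 : (M + 1 : ℝ) ≤ 65 * (m / ε ^ 2) := by
    have h1 : (M : ℝ) ≤ x := Nat.floor_le hx0
    have h2 : x ≤ 64 * (m / ε ^ 2) := by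
      rw [hx, mul_div_assoc]
      gcongr
      exact le_max_left _ _
    have h3 : 1 ≤ m / ε ^ 2 := (one_le_div hε2).2 (le_max_right _ _)
    linarith
  -- With this floor, N+1 exceeds the threshold required by `ecDiamondNorm_sub_directSum_le`, while
  -- N stays below it.
  set N := ⌊32 * (M + 1) * e / ε ^ 2⌋₊ with hN
  have hNle : (N : ℝ) ≤ 2080 * (m / ε ^ 4) * e := by
    calc (N : ℝ) ≤ 32 * (M + 1) * e / ε ^ 2 := Nat.floor_le (by positivity)
      _ ≤ 32 * (65 * (m / ε ^ 2)) * e / ε ^ 2 := by gcongr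
      _ = 2080 * (m / ε ^ 4) * e := by field_simp; ring
  obtain ⟨Q, hQR, hP, hPt, hP', hPt'⟩ := exists_isQRFactor_output (truncation U N M)
  obtain ⟨VN, hVN⟩ := exists_fockMatrix_eq hQR.1
  have htime : (factoredProgram.time (truncation U N M) : ℝ) ≤
      929500 * ((N + 1) * m ^ 2 / ε ^ 4) := by
    calc (factoredProgram.time (truncation U N M) : ℝ) ≤ 220 * ((N + 1) * (M + 1) ^ 2) := by
          exact_mod_cast hPt
      _ ≤ 220 * ((N + 1) * (65 * (m / ε ^ 2)) ^ 2) := by gcongr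
      _ = 929500 * ((N + 1) * m ^ 2 / ε ^ 4) := by field_simp; ring
  refine ⟨N, VN, ?_, fun V' => ?_, by rwa [hVN], by rw [hVN, hP], ?_, fun hεE hε' => ?_,
    by rw [hVN, hP'], ?_⟩
  · rw [hme, ← ENNReal.ofReal_mul (by positivity), ← ENNReal.ofReal_natCast]
    refine ENNReal.ofReal_le_ofReal (hNle.trans ?_)
    gcongr
    nlinarith [div_pos hm0 (by positivity : 0 < ε ^ 4)]
  · exact ecDiamondNorm_sub_directSum_le U hE hε hfin (Nat.lt_floor_add_one _).le
      (by rwa [hVN]) V'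
  · refine htime.trans ?_
    gcongr
    norm_num
  · have hmE : m = E := max_eq_left hεE
    rw [hmE] at htime hNle
    have hE0 : 0 < E := hε2.trans_le hεE
    -- Here ε² ≤ E gives x ≥ 64, so ⌊x⌋ > 0 and the dimension count with N = 0 yields e ≥ 1.
    have hM2 : 0 < ⌊x⌋₊ := by
      rw [Nat.floor_pos, hx, le_div_iff₀ hε2]
      linarith
    have he1 : 1 ≤ e := by simpa using succ_le_maximalEnergy U hfin hM2
    have h1 := one_le_mul_div_pow_four hε hεE hε' he1
    rw [hme, ← ENNReal.ofReal_mul (by positivity), ← ENNReal.ofReal_natCast]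
    refine ENNReal.ofReal_le_ofReal (htime.trans ?_)
    calc 929500 * ((N + 1 : ℝ) * E ^ 2 / ε ^ 4)
        ≤ 929500 * ((2080 * (E / ε ^ 4) * e + 4 * (E / ε ^ 4) * e) * E ^ 2 / ε ^ 4) := by gcongr
      _ = 1937078000 * (E ^ 3 / ε ^ 8 * e) := by field_simp; ring
      _ ≤ 2000000000 * (E ^ 3 / ε ^ 8 * e) := by gcongr; norm_num
      _ = 2000000000 * (E ^ 3 / ε ^ 8) * e := by ring
  · calc (entriesProgram.time (truncation U N M) : ℝ) ≤ 320 * ((N + 1) ^ 2 * (M + 1)) := by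
          exact_mod_cast hPt'
      _ ≤ 320 * ((N + 1) ^ 2 * (65 * (m / ε ^ 2))) := by gcongr
      _ = 20800 * ((N + 1) ^ 2 * (m / ε ^ 2)) := by ring
      _ ≤ 2000000000 * ((N + 1) ^ 2 * (m / ε ^ 2)) := by gcongr; norm_num
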